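/- Let $e^{(2)}=\mathrm{diag}(1,-2,1)$, $e^{(3)}=\mathrm{diag}(1,1,-2)$ and $F=\tfrac12 e^{(2)}+\tfrac12 e^{(3)}$. Consider the orthonormal basis $$n=\tfrac1{\sqrt6}(-2,1,1)^T,\qquad b_{32}=\tfrac1{\sqrt2}(0,-1,1)^T,\qquad d=\tfrac1{\sqrt3}(1,1,1)^T$$ of $\mathbb R^3$ and the open unit cube $$\Omega=\{z_1n+z_2b_{32}+z_3d:\ z_1,z_2,z_3\in(-\tfrac12,\tfrac12)\}.$$ Let $$\mathcal A_F=\{u\in H^1_{loc}(\mathbb R^3;\mathbb R^3):\ u(x)=Fx+b\ \text{for a.e. } x\in\mathbb R^3\setminus\overline\Omega,\ \text{for some } b\in\mathbb R^3\},$$ and, with $e(M)=\tfrac12(M+M^T)$, the Frobenius norm $|\cdot|$ on matrices and $|D\chi|(\Omega)$ the total variation of $\chi$ in $\Omega$, let $$E_{el}(u,\chi)=\int_\Omega|e(\nabla u)-\chi|^2\,dx,\qquad E_{surf}(\chi)=|D\chi|(\Omega).$$ Then there exist $\epsilon_0>0$ and $C>1$ such that for every $\epsilon\in(0,\epsilon_0)$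 there exist $u_\epsilon\in\mathcal A_F$ that is Lipschitz continuous on $\Omega$ and $\chi_\epsilon\in BV(\Omega;\{e^{(2)},e^{(3)}\})$ with $$E_{el}(u_\epsilon,\chi_\epsilon)+\epsilon\,E_{surf}(\chi_\epsilon)\le C\,\epsilon^{2/3}.$$ -/

import Mathlib

open MeasureTheory
open scoped ENNReal

noncomputable section

namespace CubicTetragonal

/-- Three-dimensional Euclidean space. -/
abbrev E3 : Type := EuclideanSpace ℝ (Fin 3)

/-- Real `3 × 3` matrices. -/
abbrev M3 : Type := Matrix (Fin 3) (Fin 3) ℝ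

/-- The martensitic strain `e⁽²⁾ = diag(1, -2, 1)`. -/
def e2 : M3 := !![1, 0, 0; 0, -2, 0; 0, 0, 1]

/-- The martensitic strain `e⁽³⁾ = diag(1, 1, -2)`. -/
def e3 : M3 := !![1, 0, 0; 0, 1, 0; 0, 0, -2]

/-- The boundary datum `F = ½ e⁽²⁾ + ½ e⁽³⁾`. -/
def F : M3 := (1 / 2 : ℝ) • e2 + (1 / 2 : ℝ) • e3

/-- The unit vector `n = (-2, 1, 1) / √6`. -/
def nVec : E3 := (1 / √6 : ℝ) • !₂[-2, 1, 1]

/-- The unit vector `b₃₂ = (0, -1, 1) / √2`. -/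
def b32 : E3 := (1 / √2 : ℝ) • !₂[0, -1, 1]

/-- The unit vector `d = (1, 1, 1) / √3`. -/
def dVec : E3 := (1 / √3 : ℝ) • !₂[1, 1, 1]

/-- The open unit cube
`Ω = (-½, ½) n × (-½, ½) b₃₂ × (-½, ½) d` in the orthonormal basis `n, b₃₂, d`. -/
def Ω : Set E3 :=
  {x | ∃ z₁ ∈ Set.Ioo (-1 / 2 : ℝ) (1 / 2), ∃ z₂ ∈ Set.Ioo (-1 / 2 : ℝ) (1 / 2),
    ∃ z₃ ∈ Set.Ioo (-1 / 2 : ℝ) (1 / 2), x = z₁ • nVec + z₂ • b32 + z₃ • dVec}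

/-- The partial derivative `∂ₖ φ` of a scalar function. -/
def pderiv (k : Fin 3) (φ : E3 → ℝ) (x : E3) : ℝ :=
  fderiv ℝ φ x (EuclideanSpace.single k 1)

/-- `G` is a weak (distributional) gradient of `u` on the whole space: both are locally
integrable and `∫ uᵢ ∂ⱼφ = - ∫ Gᵢⱼ φ` for all smooth compactly supported `φ`. -/
def IsWeakGradient (u : E3 → E3) (G : E3 → M3) : Prop :=
  (∀ i, LocallyIntegrable (fun x => u x i)) ∧
  (∀ i j, LocallyIntegrable (fun x => G x i j)) ∧
  ∀ i j, ∀ φ : E3 → ℝ, ContDiff ℝ (⊤ : ℕ∞) φ → HasCompactSupport φ →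
    ∫ x, u x i * pderiv j φ x = - ∫ x, G x i j * φ x

/-- A real function is in `L²_loc(ℝ³)`. -/
def MemL2loc (f : E3 → ℝ) : Prop :=
  ∀ A : Set E3, IsCompact A → MemLp f 2 (volume.restrict A)

/-- `u ∈ H¹_loc(ℝ³; ℝ³)`. -/
def MemH1loc (u : E3 → E3) : Prop :=
  (∀ i, MemL2loc (fun x => u x i)) ∧
  ∃ G, IsWeakGradient u G ∧ ∀ i j, MemL2loc (fun x => G x i j)

/-- The admissible class `𝒜_M` on a domain `U`: all `u ∈ H¹_loc(ℝ³; ℝ³)` with `u(x) = M x + b`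
for (almost) every `x` outside the closure of `U`, for some constant `b`. -/
def admissible (U : Set E3) (M : M3) : Set (E3 → E3) :=
  {u | MemH1loc u ∧ ∃ b : E3, ∀ᵐ x : E3, x ∉ closure U → u x = Matrix.toEuclideanLin M x + b}

/-- The symmetric part `e(M) = ½ (M + Mᵀ)`. -/
def symPart (M : M3) : M3 := (1 / 2 : ℝ) • (M + M.transpose)

/-- The squared Frobenius norm `|M|²`. -/
def frobSq (M : M3) : ℝ := ∑ i, ∑ j, M i j ^ 2

/-- The elastic energy `∫_U |e(∇u) - χ|² dx`, as an extended nonnegative number.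
The weak gradient of `u` is unique up to null sets, so that the infimum ranges over a single
value; it is `∞` if `u` has no weak gradient. -/
def elasticEnergy (U : Set E3) (u : E3 → E3) (χ : E3 → M3) : ℝ≥0∞ :=
  ⨅ (G : E3 → M3) (_ : IsWeakGradient u G),
    ∫⁻ x in U, ENNReal.ofReal (frobSq (symPart (G x) - χ x))

/-- Test fields for the total variation in `U`: `C¹` fields with values in `ℝ^{3×3×3}`,
compactly supported in `U` and with Euclidean norm at most one at every point. -/
def IsTestField (U : Set E3) (φ : Fin 3 → Fin 3 → Fin 3 → E3 → ℝ) : Prop :=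
  (∀ i j k, ContDiff ℝ 1 (φ i j k) ∧ HasCompactSupport (φ i j k) ∧ tsupport (φ i j k) ⊆ U) ∧
  ∀ x, ∑ i, ∑ j, ∑ k, φ i j k x ^ 2 ≤ 1

/-- The surface energy, i.e. the total variation `|Dχ|(U)` of a matrix field in an open set `U`. -/
def surfaceEnergy (U : Set E3) (χ : E3 → M3) : ℝ≥0∞ :=
  ⨆ (φ : Fin 3 → Fin 3 → Fin 3 → E3 → ℝ) (_ : IsTestField U φ),
    ENNReal.ofReal (∫ x in U, ∑ i, ∑ j, ∑ k, χ x i j * pderiv k (φ i j k) x)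

/-- `χ ∈ BV(U; S)`: `χ` is integrable on `U`, takes values in `S` almost everywhere in `U`, and
has finite total variation in `U`. -/
def MemBV (U : Set E3) (S : Set M3) (χ : E3 → M3) : Prop :=
  (∀ i j, IntegrableOn (fun x => χ x i j) U) ∧
  (∀ᵐ x ∂(volume.restrict U), χ x ∈ S) ∧
  surfaceEnergy U χ < (⊤ : ℝ≥0∞)

end CubicTetragonal

end

open CubicTetragonal

open MeasureTheory
open scoped ENNReal

/-! The strains `e2` and `e3` are compatible across planes normal to `b32`: `e2 - F` is three times
the symmetrised product of `b23` and `b32`, and `e3 - F` is its negative. So `F x + 3 φ b23`, with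
`φ` a zigzag of slopes `±1` along `b32`, has strain exactly in the two wells wherever `φ` does not
vary tangentially. To meet the boundary datum, `φ` must vanish on the lateral faces (normal to `n`
and `d`), so the zigzag refines towards them: at distance `r` its period is comparable to `a(r) = h
r^(2/3)`.

The profile is 1-Lipschitz in `a`, so tangential derivatives are of order `a'(r)`, about `h
r^(-1/3)`, and the elastic density is of order `h² r^(-2/3)`. The interfaces per line number about
`1 / a`, so the surface density is of order `h⁻¹ r^(-2/3)`. Both carry the same integrable weight
`r^(-2/3)`. In the layer `r ≤ h³`, where `a` would exceed `r`, `φ` is cut off by the distance to the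
boundary, and its bounded error is again below `h² r^(-2/3)`. The total is of order `h² + ε / h`,
balanced by `h` comparable to `ε^(1/3)`.

The main estimates are `branchProfile_cell` (shape of the profile), `lintegral_slope_sub_le`
(surface term), and `sum_sq_fderiv_cutLaminate_le` with `frobSq_symPart_sub_phase_le` (elastic
term). -/

namespace CubicTetragonal

/-! ### The one-dimensional profile -/

/-- The branching profile: a zigzag in `y` with slopes `±1`, whose period is comparable to `a` and
which refines continuously (by period halving of `h ℤ`) as `a` decreases to zero. -/
noncomputable def branchProfile (h a y : ℝ) : ℝ :=
  ⨅ p : ℕ × ℤ, (|y - p.2 * (h / 2 ^ p.1)| + max 0 (a - h / 2 ^ p.1))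

theorem branchProfile_bddBelow (h a y : ℝ) :
    BddBelow (Set.range fun p : ℕ × ℤ => |y - p.2 * (h / 2 ^ p.1)| + max 0 (a - h / 2 ^ p.1)) :=
  ⟨0, by rintro _ ⟨p, rfl⟩; positivity⟩

theorem branchProfile_nonneg (h a y : ℝ) : 0 ≤ branchProfile h a y :=
  le_ciInf fun p => by positivity

theorem branchProfile_le (h a y : ℝ) (i : ℕ) (j : ℤ) :
    branchProfile h a y ≤ |y - j * (h / 2 ^ i)| + max 0 (a - h / 2 ^ i) :=
  ciInf_le (branchProfile_bddBelow h a y) (i, j)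

/-- Each competitor in the infimum is 1-Lipschitz in `a` and in `y`, and infima keep this. The bound
in `a` is what makes refinement cheap. -/
theorem branchProfile_le_add (h a a' y y' : ℝ) :
    branchProfile h a y ≤ branchProfile h a' y' + (|a - a'| + |y - y'|) := by
  rw [← sub_le_iff_le_add]
  refine le_ciInf fun p => ?_
  have h1 := branchProfile_le h a y p.1 p.2
  have h2 : |y - p.2 * (h / 2 ^ p.1)| ≤ |y - y'| + |y' - p.2 * (h / 2 ^ p.1)| :=
    abs_sub_le _ _ _
  have h3 : max 0 (a - h / 2 ^ p.1) ≤ max 0 (a' - h / 2 ^ p.1) + |a - a'| := by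
    have := le_abs_self (a - a')
    have := abs_nonneg (a - a')
    refine max_le (by positivity) ?_
    have := le_max_right 0 (a' - h / 2 ^ p.1)
    linarith
  linarith

theorem abs_branchProfile_sub_le (h a a' y y' : ℝ) :
    |branchProfile h a y - branchProfile h a' y'| ≤ |a - a'| + |y - y'| := by
  have h1 := branchProfile_le_add h a a' y y'
  have h2 := branchProfile_le_add h a' a y' y
  rw [abs_sub_comm a' a, abs_sub_comm y' y] at h2
  rw [abs_le]
  constructor <;> linarith

/-- The explicit shape of the profile on one cell of the `k`-th generation. -/
theorem branchProfile_cell {h a τ : ℝ} (hh : 0 < h) (k : ℕ) (l : ℤ)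
    (ha : h / 2 ^ k / 2 ≤ a) (ha' : a ≤ h / 2 ^ k) (hτ : |τ| ≤ h / 2 ^ k / 2) :
    branchProfile h a (l * (h / 2 ^ k) + τ) = min |τ| (a - |τ|) := by
  set H := h / 2 ^ k with hH
  have hHpos : 0 < H := by positivity
  -- Upper bound: test with the cell centre, and with the neighbouring midpoint of generation `k +
  -- 1`, whose penalty is `a - H / 2`.
  apply le_antisymm
  · refine le_min ?_ ?_
    · refine (branchProfile_le h a _ k l).trans ?_
      rw [← hH, add_sub_cancel_left, max_eq_left (by linarith), add_zero]
    · have hk : h / 2 ^ (k + 1) = H / 2 := by rw [hH, pow_succ]; field_simp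
      rcases le_total 0 τ with h0 | h0
      · refine (branchProfile_le h a _ (k + 1) (2 * l + 1)).trans ?_
        rw [hk, max_eq_right (by linarith)]
        rw [abs_of_nonneg h0] at hτ ⊢
        push_cast
        rw [abs_of_nonpos (by linarith)]
        linarith
      · refine (branchProfile_le h a _ (k + 1) (2 * l - 1)).trans ?_
        rw [hk, max_eq_right (by linarith)]
        rw [abs_of_nonpos h0] at hτ ⊢
        push_cast
        rw [abs_of_nonneg (by linarith)]
        linarith
  -- Lower bound: from generation `k + 2` on, the penalty alone is at least `a - H / 4 ≥ a / 2`.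
  -- Coarser grid points are multiples `r * (H / 2)`, and `r = ±1` occurs only in generation `k +
  -- 1`.
  · refine le_ciInf fun ⟨i, j⟩ => ?_
    simp only
    rcases Nat.lt_or_ge (k + 1) i with hi | hi
    · obtain ⟨d, rfl⟩ : ∃ d, i = k + 2 + d := ⟨i - (k + 2), by omega⟩
      have h1 : h / 2 ^ (k + 2 + d) ≤ H / 4 := by
        have : h / 2 ^ (k + 2 + d) = H / 4 / 2 ^ d := by
          rw [hH, pow_add, pow_add]; field_simp; ring
        rw [this]
        exact div_le_self (by positivity) (one_le_pow₀ (by norm_num))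
      have h2 := le_max_right 0 (a - h / 2 ^ (k + 2 + d))
      have h3 := abs_nonneg (l * H + τ - j * (h / 2 ^ (k + 2 + d)))
      have h4 : min |τ| (a - |τ|) ≤ a / 2 := by
        rcases le_total |τ| (a / 2) with h | h
        · exact (min_le_left _ _).trans h
        · exact (min_le_right _ _).trans (by linarith)
      linarith
    · obtain ⟨r, hr, hodd⟩ : ∃ r : ℤ, (j : ℝ) * (h / 2 ^ i) = l * H + r * (H / 2) ∧
          (r = 1 ∨ r = -1 → i = k + 1) := by
        rcases Nat.lt_or_ge k i with hi' | hi'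
        · obtain rfl : i = k + 1 := by omega
          refine ⟨j - 2 * l, ?_, fun _ => rfl⟩
          rw [hH, pow_succ]; push_cast; field_simp; ring
        · obtain ⟨d, rfl⟩ := Nat.exists_eq_add_of_le hi'
          refine ⟨2 * (j * 2 ^ d - l), ?_, fun h => by omega⟩
          rw [hH, pow_add]; push_cast; field_simp; ring
      rw [hr, add_sub_add_left_eq_sub]
      have h5 : |(r : ℝ) * (H / 2)| - |τ| ≤ |τ - r * (H / 2)| := by
        rw [abs_sub_comm τ]; exact abs_sub_abs_le_abs_sub _ _
      rw [abs_mul, abs_of_pos (show 0 < H / 2 by positivity)] at h5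
      have hm := le_max_left 0 (a - h / 2 ^ i)
      have hm' := le_max_right 0 (a - h / 2 ^ i)
      by_cases hr0 : r = 0
      · subst hr0
        refine (min_le_left _ _).trans ?_
        simp
      · by_cases hr1 : r = 1 ∨ r = -1
        · have hk : h / 2 ^ i = H / 2 := by rw [hodd hr1, hH, pow_succ]; field_simp
          have : |(r : ℝ)| = 1 := by rcases hr1 with rfl | rfl <;> simp
          rw [this] at h5
          rw [hk] at hm' ⊢
          refine (min_le_right _ _).trans ?_
          linarith
        · have : (2 : ℝ) ≤ |(r : ℝ)| := by
            have : (2 : ℤ) ≤ |r| := by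
              push Not at hr1
              rcases le_total 0 r with h | h
              · rw [abs_of_nonneg h]; omega
              · rw [abs_of_nonpos h]; omega
            exact_mod_cast this
          have : 2 * (H / 2) ≤ |(r : ℝ)| * (H / 2) := by gcongr
          refine (min_le_left _ _).trans ?_
          linarith

/-- At scale `a ≤ h` the profile consists of at most `16 / a` affine pieces of slope `±1` over
the unit interval. -/
theorem branchProfile_pieces {h a : ℝ} {m : ℕ} (hm : 0 < m) (hh : h = 1 / (2 * m)) (ha : 0 < a)
    (ha' : a ≤ h) :
    ∃ (s : Finset ℤ) (l r c ς : ℤ × Fin 4 → ℝ), (s.card : ℝ) * 4 ≤ 8 / a ∧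
      (∀ p, ς p = 1 ∨ ς p = -1) ∧
      (∀ p, ∀ y ∈ Set.Icc (l p) (r p), branchProfile h a y = c p + ς p * y) ∧
      Set.Ioo (-1 / 2 : ℝ) (1 / 2) ⊆ ⋃ p ∈ s ×ˢ (Finset.univ : Finset (Fin 4)),
        Set.Icc (l p) (r p) := by
  have hmR : (0 : ℝ) < m := by exact_mod_cast hm
  have hhpos : 0 < h := by rw [hh]; positivity
  -- The generation `k` with `H / 2 < a ≤ H`.
  obtain ⟨k, hk1, hk2⟩ := exists_nat_pow_near_of_lt_one (x := a / h) (y := 1 / 2)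
    (by positivity) (by rw [div_le_one hhpos]; exact ha') (by norm_num) (by norm_num)
  set H := h / 2 ^ k with hH
  have hHpos : 0 < H := by positivity
  have hb1 : H / 2 ≤ a := by
    rw [lt_div_iff₀ hhpos] at hk1
    have : (1 / 2 : ℝ) ^ (k + 1) * h = H / 2 := by
      rw [hH, pow_succ, div_pow, one_pow]; field_simp
    linarith
  have hb2 : a ≤ H := by
    rw [div_le_iff₀ hhpos] at hk2
    have : (1 / 2 : ℝ) ^ k * h = H := by rw [hH, div_pow, one_pow]; field_simp
    linarith
  have hMH : ((m * 2 ^ k : ℕ) : ℝ) * H = 1 / 2 := by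
    rw [hH, hh]; push_cast; field_simp
  set M : ℕ := m * 2 ^ k with hM
  have hM1 : (1 : ℝ) ≤ M := by
    have : 0 < M := by positivity
    exact_mod_cast this
  have hcell := fun (i : ℤ) (τ : ℝ) (hτ : |τ| ≤ H / 2) =>
    branchProfile_cell hhpos k i hb1 hb2 hτ
  refine ⟨Finset.Icc (-(M : ℤ)) M,
    fun p => p.1 * H + ![-(H / 2), -(a / 2), 0, a / 2] p.2,
    fun p => p.1 * H + ![-(a / 2), 0, a / 2, H / 2] p.2,
    fun p => ![a - p.1 * H, p.1 * H, -(p.1 * H), a + p.1 * H] p.2,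
    fun p => ![1, -1, 1, -1] p.2, ?_, ?_, ?_, ?_⟩
  -- With `M * H = 1 / 2` and `a ≤ H`, four pieces in each of `2 M + 1 ≤ 3 M` cells number at most
  -- `6 / a`.
  · have : ((Finset.Icc (-(M : ℤ)) M).card : ℝ) = 2 * M + 1 := by
      rw [Int.card_Icc]
      have : ((M : ℤ) + 1 - -(M : ℤ)).toNat = 2 * M + 1 := by omega
      rw [this]; push_cast; ring
    rw [this, le_div_iff₀ ha]
    nlinarith
  · rintro ⟨i, j⟩; fin_cases j <;> simp
  · rintro ⟨i, j⟩ y hy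
    have hy' : y = i * H + (y - i * H) := by ring
    have hc := hcell i (y - i * H)
    rw [← hy'] at hc
    fin_cases j <;> simp at hy ⊢ <;> obtain ⟨h1, h2⟩ := hy
    · rw [abs_of_nonpos (by linarith)] at hc
      rw [hc (by linarith), min_eq_right (by linarith)]; ring
    · rw [abs_of_nonpos (by linarith)] at hc
      rw [hc (by linarith), min_eq_left (by linarith)]; ring
    · rw [abs_of_nonneg (by linarith)] at hc
      rw [hc (by linarith), min_eq_left (by linarith)]; ring
    · rw [abs_of_nonneg (by linarith)] at hc
      rw [hc (by linarith), min_eq_right (by linarith)]; ring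
  · intro y hy
    set i := round (y / H) with hi
    have hi1 : |y / H - i| ≤ 1 / 2 := abs_sub_round _
    have hi2 : |y - i * H| ≤ H / 2 := by
      have : y - i * H = (y / H - i) * H := by field_simp
      rw [this, abs_mul, abs_of_pos hHpos]
      nlinarith
    rw [abs_le] at hi2
    have hiM : i ∈ Finset.Icc (-(M : ℤ)) M := by
      rw [Finset.mem_Icc]
      constructor
      · have : (-(M : ℝ) - 1) < i := by
          by_contra hcon
          push Not at hcon
          nlinarith [hy.1]
        have : (-(M : ℤ) - 1) < i := by exact_mod_cast this
        omega
      · have : (i : ℝ) < M + 1 := by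
          by_contra hcon
          push Not at hcon
          nlinarith [hy.2]
        have : i < (M : ℤ) + 1 := by exact_mod_cast this
        omega
    simp only [Set.mem_iUnion]
    have hmem : ∀ j : Fin 4, (i, j) ∈ Finset.Icc (-(M : ℤ)) M ×ˢ (Finset.univ : Finset (Fin 4)) :=
      fun j => Finset.mem_product.2 ⟨hiM, Finset.mem_univ _⟩
    rcases le_total (y - i * H) 0 with h0 | h0
    · rcases le_total (y - i * H) (-(a / 2)) with h1 | h1
      · exact ⟨(i, 0), hmem _, by simp; constructor <;> linarith⟩
      · exact ⟨(i, 1), hmem _, by simp; constructor <;> linarith⟩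
    · rcases le_total (y - i * H) (a / 2) with h1 | h1
      · exact ⟨(i, 2), hmem _, by simp; constructor <;> linarith⟩
      · exact ⟨(i, 3), hmem _, by simp; constructor <;> linarith⟩

/-- If a `1`-Lipschitz function stays `η`-close to an affine function of slope `±1` on an interval,
then its derivative is `2η`-close to that slope in `L¹`. -/
theorem lintegral_abs_sub_deriv_le {g : ℝ → ℝ} (hg : LipschitzWith 1 g) {l r c ς η : ℝ}
    (hς : ς = 1 ∨ ς = -1) (h : ∀ y ∈ Set.Icc l r, |c + ς * y - g y| ≤ η) :
    ∫⁻ y in Set.Icc l r, ENNReal.ofReal |ς - deriv g y| ≤ ENNReal.ofReal (2 * η) := by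
  rcases lt_or_ge r l with hlr | hlr
  · simp [Set.Icc_eq_empty_of_lt hlr]
  have hac : AbsolutelyContinuousOnInterval g l r :=
    (hg.lipschitzOnWith (s := Set.uIcc l r)).absolutelyContinuousOnInterval
  have hder : ∀ y, |deriv g y| ≤ 1 := fun y => by
    simpa using norm_deriv_le_of_lipschitz hg (x₀ := y)
  -- As `|g'| ≤ 1` and `ς = ±1`, the absolute value has a fixed sign, so the fundamental theorem of
  -- calculus integrates it exactly and only two endpoint errors remain.
  have hbd : ∀ y, |ς - deriv g y| = 1 - ς * deriv g y := by
    intro y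
    have := abs_le.1 (hder y)
    rcases hς with rfl | rfl
    · rw [abs_of_nonneg (by linarith)]; ring
    · rw [abs_of_nonpos (by linarith)]; ring
  have hint : IntervalIntegrable (deriv g) volume l r := hac.intervalIntegrable_deriv
  have hint' : IntegrableOn (fun y => 1 - ς * deriv g y) (Set.Icc l r) := by
    rw [integrableOn_Icc_iff_integrableOn_Ioc, ← intervalIntegrable_iff_integrableOn_Ioc_of_le hlr]
    exact intervalIntegrable_const.sub (hint.const_mul ς)
  simp_rw [hbd]
  rw [← ofReal_integral_eq_lintegral_ofReal hint'
    (Filter.Eventually.of_forall fun y => by simp [← hbd])]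
  apply ENNReal.ofReal_le_ofReal
  rw [integral_Icc_eq_integral_Ioc, ← intervalIntegral.integral_of_le hlr,
    intervalIntegral.integral_sub intervalIntegrable_const (hint.const_mul ς),
    intervalIntegral.integral_const_mul, hac.integral_deriv_eq_sub]
  have h1 := abs_le.1 (h l (Set.left_mem_Icc.2 hlr))
  have h2 := abs_le.1 (h r (Set.right_mem_Icc.2 hlr))
  simp only [intervalIntegral.integral_const, smul_eq_mul, mul_one]
  rcases hς with rfl | rfl <;> linarith

/-! ### The orthonormal frame and Fubini on the cube -/

theorem orthonormal_frame : Orthonormal ℝ ![nVec, b32, dVec] := by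
  constructor
  · intro i
    fin_cases i <;>
      simp [nVec, b32, dVec, norm_smul, EuclideanSpace.norm_eq, Fin.sum_univ_three,
        abs_of_nonneg (Real.sqrt_nonneg _)] <;> norm_num
  · intro i j hij
    fin_cases i <;> fin_cases j <;>
      simp [nVec, b32, dVec, PiLp.inner_apply, Fin.sum_univ_three] at hij ⊢ <;> ring

/-- The orthonormal basis `n, b₃₂, d`. -/
noncomputable def frame : OrthonormalBasis (Fin 3) ℝ E3 :=
  OrthonormalBasis.mk orthonormal_frame
    (orthonormal_frame.linearIndependent.span_eq_top_of_card_eq_finrank (by simp)).ge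

@[simp] theorem frame_zero : frame 0 = nVec := by simp [frame]
@[simp] theorem frame_one : frame 1 = b32 := by simp [frame]
@[simp] theorem frame_two : frame 2 = dVec := by simp [frame]

theorem mem_Ω_iff (x : E3) : x ∈ Ω ↔ ∀ i, |frame.repr x i| < 1 / 2 := by
  constructor
  · rintro ⟨z₁, h₁, z₂, h₂, z₃, h₃, rfl⟩ i
    have h : z₁ • nVec + z₂ • b32 + z₃ • dVec = frame.repr.symm !₂[z₁, z₂, z₃] := by
      rw [← frame_zero, ← frame_one, ← frame_two, ← frame.sum_repr_symm, Fin.sum_univ_three]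
      simp
    rw [h, LinearIsometryEquiv.apply_symm_apply, abs_lt]
    fin_cases i
    · exact ⟨by have := h₁.1; simp; linarith, h₁.2⟩
    · exact ⟨by have := h₂.1; simp; linarith, h₂.2⟩
    · exact ⟨by have := h₃.1; simp; linarith, h₃.2⟩
  · intro h
    have h' : ∀ i, frame.repr x i ∈ Set.Ioo (-1 / 2 : ℝ) (1 / 2) := fun i => by
      have := abs_lt.1 (h i)
      exact ⟨by linarith, this.2⟩
    refine ⟨_, h' 0, _, h' 1, _, h' 2, ?_⟩
    conv_lhs => rw [← frame.sum_repr x]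
    simp [Fin.sum_univ_three]

/-- The point with coordinates `p.1, y, p.2` in the basis `n, b₃₂, d`. -/
noncomputable def framePoint (p : ℝ × ℝ) (y : ℝ) : E3 := frame.repr.symm !₂[p.1, y, p.2]

theorem isOpen_Ω : IsOpen Ω := by
  have : Ω = ⋂ i, {x | |frame.repr x i| < 1 / 2} := by ext x; simp [mem_Ω_iff]
  rw [this]
  exact isOpen_iInter_of_finite fun i => isOpen_lt (by fun_prop) continuous_const

theorem continuous_framePoint : Continuous fun q : (ℝ × ℝ) × ℝ => framePoint q.1 q.2 := by
  unfold framePoint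
  refine frame.repr.symm.continuous.comp ?_
  refine (PiLp.continuous_toLp 2 _).comp (continuous_pi fun i => ?_)
  fin_cases i <;> simp <;> fun_prop

@[simp] theorem repr_framePoint (p : ℝ × ℝ) (y : ℝ) :
    frame.repr (framePoint p y) = !₂[p.1, y, p.2] := by
  simp [framePoint]

theorem framePoint_add (p : ℝ × ℝ) (y t : ℝ) :
    framePoint p (y + t) = framePoint p y + t • b32 := by
  apply frame.repr.injective
  rw [map_add, map_smul, ← frame_one, frame.repr_self, repr_framePoint, repr_framePoint]
  ext i
  fin_cases i <;> simp

theorem framePoint_mem_Ω (p : ℝ × ℝ) (y : ℝ) :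
    framePoint p y ∈ Ω ↔ (|p.1| < 1 / 2 ∧ |p.2| < 1 / 2) ∧ |y| < 1 / 2 := by
  rw [mem_Ω_iff, Fin.forall_fin_succ, Fin.forall_fin_two]
  simp
  tauto

theorem measurePreserving_framePoint :
    MeasurePreserving (fun q : (ℝ × ℝ) × ℝ => framePoint q.1 q.2)
      ((volume.prod volume).prod volume) volume := by
  have h1 := (volume_preserving_piFinSuccAbove (fun _ : Fin 3 => ℝ) 1).symm
  have h2 := (volume_preserving_finTwoArrow ℝ).symm
  have h3 : MeasurePreserving (fun q : (ℝ × ℝ) × ℝ =>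
      (q.2, (MeasurableEquiv.finTwoArrow (α := ℝ)).symm q.1))
      ((volume.prod volume).prod volume) (volume.prod volume) :=
    ((MeasurePreserving.id volume).prod h2).comp Measure.measurePreserving_swap
  have h4 := frame.measurePreserving_repr_symm.comp
    ((PiLp.volume_preserving_toLp (Fin 3)).comp (h1.comp h3))
  convert h4 using 1
  funext q
  simp only [framePoint, Function.comp]
  congr 2
  ext i
  fin_cases i <;> rfl

/-- The inner integral runs across the layers, where the laminate is piecewise affine. -/
theorem lintegral_Ω {f : E3 → ℝ≥0∞} (hf : Measurable f) :
    ∫⁻ x in Ω, f x = ∫⁻ p in Set.Ioo (-1 / 2 : ℝ) (1 / 2) ×ˢ Set.Ioo (-1 / 2 : ℝ) (1 / 2),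
      ∫⁻ y in Set.Ioo (-1 / 2 : ℝ) (1 / 2), f (framePoint p y) := by
  rw [← measurePreserving_framePoint.setLIntegral_comp_preimage isOpen_Ω.measurableSet hf]
  have : (fun q : (ℝ × ℝ) × ℝ => framePoint q.1 q.2) ⁻¹' Ω =
      (Set.Ioo (-1 / 2 : ℝ) (1 / 2) ×ˢ Set.Ioo (-1 / 2 : ℝ) (1 / 2)) ×ˢ
        Set.Ioo (-1 / 2 : ℝ) (1 / 2) := by
    ext q
    simp only [Set.mem_preimage, framePoint_mem_Ω, abs_lt, Set.mem_prod, Set.mem_Ioo, neg_div]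
  rw [this, ← Measure.prod_restrict, lintegral_prod]
  · rfl
  · exact (hf.comp continuous_framePoint.measurable).aemeasurable

/-! ### The refinement scale -/

/-- In terms of the cube roots `p ≥ q` this is `q p² ≤ p³`; the sharp tangent constant `2 / 3` is
not needed. -/
theorem rpow_two_thirds_sub_le {r s : ℝ} (hs : 0 < s) (hsr : s ≤ r) :
    r ^ (2 / 3 : ℝ) - s ^ (2 / 3 : ℝ) ≤ s ^ (-1 / 3 : ℝ) * (r - s) := by
  have hr : 0 < r := hs.trans_le hsr
  have h2 : ∀ x : ℝ, 0 < x → x ^ (2 / 3 : ℝ) = (x ^ (1 / 3 : ℝ)) ^ 2 := fun x hx => by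
    rw [← Real.rpow_natCast, ← Real.rpow_mul hx.le]; norm_num
  have h3 : ∀ x : ℝ, 0 < x → x = (x ^ (1 / 3 : ℝ)) ^ 3 := fun x hx => by
    rw [← Real.rpow_natCast, ← Real.rpow_mul hx.le]; norm_num
  have hn : s ^ (-1 / 3 : ℝ) = (s ^ (1 / 3 : ℝ))⁻¹ := by
    rw [← Real.rpow_neg hs.le]; norm_num
  have hpq : s ^ (1 / 3 : ℝ) ≤ r ^ (1 / 3 : ℝ) := Real.rpow_le_rpow hs.le hsr (by norm_num)
  have hq : 0 < s ^ (1 / 3 : ℝ) := Real.rpow_pos_of_pos hs _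
  have e : r - s = (r ^ (1 / 3 : ℝ)) ^ 3 - (s ^ (1 / 3 : ℝ)) ^ 3 := by rw [← h3 r hr, ← h3 s hs]
  rw [hn, h2 r hr, h2 s hs, e]
  set p := r ^ (1 / 3 : ℝ)
  set q := s ^ (1 / 3 : ℝ)
  rw [inv_mul_eq_div, le_div_iff₀ hq]
  nlinarith [mul_le_mul_of_nonneg_left hpq (sq_nonneg p)]

/-- The period of the laminate at distance `r` from the lateral faces. -/
noncomputable def scale (h r : ℝ) : ℝ := h * max r (h ^ 3) ^ (2 / 3 : ℝ)

theorem scale_pos {h : ℝ} (hh : 0 < h) (r : ℝ) : 0 < scale h r := by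
  have : 0 < max r (h ^ 3) := lt_max_of_lt_right (by positivity)
  unfold scale
  positivity

theorem scale_le {h r : ℝ} (hh : 0 < h) (h1 : h ≤ 1) (hr : r ≤ 1) : scale h r ≤ h := by
  have : 0 < max r (h ^ 3) := lt_max_of_lt_right (by positivity)
  have h2 : max r (h ^ 3) ≤ 1 := max_le hr (pow_le_one₀ hh.le h1)
  calc scale h r ≤ h * 1 := by
        unfold scale; gcongr; exact Real.rpow_le_one this.le h2 (by norm_num)
    _ = h := mul_one h

theorem le_scale {h r : ℝ} (hh : 0 < h) (hr : 0 < r) : h * r ^ (2 / 3 : ℝ) ≤ scale h r := by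
  unfold scale
  gcongr
  exact le_max_left _ _

theorem cube_rpow_one_third {h : ℝ} (hh : 0 < h) : (h ^ 3) ^ (1 / 3 : ℝ) = h := by
  rw [← Real.rpow_natCast, ← Real.rpow_mul hh.le]; norm_num

theorem cube_rpow_neg_one_third {h : ℝ} (hh : 0 < h) : (h ^ 3) ^ (-1 / 3 : ℝ) = h⁻¹ := by
  rw [neg_div, Real.rpow_neg (by positivity), cube_rpow_one_third hh]

/-- The threshold `h ^ 3` is where `h r^(2/3) = r`. Beyond it the laminate, bounded by its scale,
stays below the distance to the lateral faces. -/
theorem scale_le_self {h r : ℝ} (hh : 0 < h) (hr : h ^ 3 ≤ r) : scale h r ≤ r := by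
  have hr0 : 0 < r := lt_of_lt_of_le (by positivity) hr
  rw [scale, max_eq_left hr]
  have h1 : h ≤ r ^ (1 / 3 : ℝ) := by
    rw [← cube_rpow_one_third hh]
    exact Real.rpow_le_rpow (by positivity) hr (by norm_num)
  calc h * r ^ (2 / 3 : ℝ) ≤ r ^ (1 / 3 : ℝ) * r ^ (2 / 3 : ℝ) := by gcongr
    _ = r := by rw [← Real.rpow_add hr0]; norm_num

/-- Used with `s = h ^ 3` for the global Lipschitz bound, and with `s` a fraction of the distance
for the local rate `h r^(-1/3)`. -/
theorem abs_scale_sub_le_of_le {h r r' s : ℝ} (hh : 0 < h) (hs : 0 < s) (h1 : s ≤ max r (h ^ 3))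
    (h2 : s ≤ max r' (h ^ 3)) :
    |scale h r - scale h r'| ≤ h * s ^ (-1 / 3 : ℝ) * |r - r'| := by
  wlog hrr : r' ≤ r generalizing r r'
  · rw [abs_sub_comm, abs_sub_comm r]
    exact this h2 h1 (le_of_not_ge hrr)
  have hm : max r' (h ^ 3) ≤ max r (h ^ 3) := max_le_max_right _ hrr
  have hm' : max r (h ^ 3) - max r' (h ^ 3) ≤ r - r' := by
    have := le_max_left r' (h ^ 3)
    have := le_max_right r' (h ^ 3)
    rw [sub_le_iff_le_add]
    exact max_le (by linarith) (by linarith)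
  have h0 : 0 < max r' (h ^ 3) := hs.trans_le h2
  have h3 := rpow_two_thirds_sub_le h0 hm
  have h4 : max r' (h ^ 3) ^ (-1 / 3 : ℝ) ≤ s ^ (-1 / 3 : ℝ) :=
    Real.rpow_le_rpow_of_nonpos hs h2 (by norm_num)
  have h5 : scale h r' ≤ scale h r := by
    unfold scale
    gcongr
  rw [abs_of_nonneg (sub_nonneg.2 h5), abs_of_nonneg (sub_nonneg.2 hrr)]
  calc scale h r - scale h r'
      = h * (max r (h ^ 3) ^ (2 / 3 : ℝ) - max r' (h ^ 3) ^ (2 / 3 : ℝ)) := by unfold scale; ring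
    _ ≤ h * (max r' (h ^ 3) ^ (-1 / 3 : ℝ) * (max r (h ^ 3) - max r' (h ^ 3))) := by gcongr
    _ ≤ h * (s ^ (-1 / 3 : ℝ) * (r - r')) := by
        gcongr
    _ = _ := by ring

theorem abs_scale_sub_le {h : ℝ} (hh : 0 < h) (r r' : ℝ) :
    |scale h r - scale h r'| ≤ |r - r'| := by
  have h1 := abs_scale_sub_le_of_le (r := r) (r' := r') hh (pow_pos hh 3) (le_max_right _ _)
    (le_max_right _ _)
  rwa [cube_rpow_neg_one_third hh, mul_inv_cancel₀ hh.ne', one_mul] at h1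

/-! ### The laminate and its slope across the layers -/

/-- The signed distance to the lateral faces of a point with given coordinates along `n`, `d`. -/
noncomputable def lateralDist (p : ℝ × ℝ) : ℝ := min (1 / 2 - |p.1|) (1 / 2 - |p.2|)

/-- The coordinates along `n` and `d`. -/
noncomputable def lateral (x : E3) : ℝ × ℝ := (frame.repr x 0, frame.repr x 2)

theorem lateral_framePoint (p : ℝ × ℝ) (y : ℝ) : lateral (framePoint p y) = p := by
  simp [lateral]

theorem abs_repr_sub_le (x x' : E3) (i : Fin 3) :
    |frame.repr x i - frame.repr x' i| ≤ ‖x - x'‖ := by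
  have := PiLp.norm_apply_le (frame.repr (x - x')) i
  rw [frame.repr.norm_map, map_sub] at this
  exact this

theorem abs_lateralDist_sub_le (x x' : E3) :
    |lateralDist (lateral x) - lateralDist (lateral x')| ≤ ‖x - x'‖ := by
  refine (abs_min_sub_min_le_max _ _ _ _).trans (max_le ?_ ?_)
  · rw [sub_sub_sub_cancel_left, abs_sub_comm]
    exact (abs_abs_sub_abs_le _ _).trans (abs_repr_sub_le x x' 0)
  · rw [sub_sub_sub_cancel_left, abs_sub_comm]
    exact (abs_abs_sub_abs_le _ _).trans (abs_repr_sub_le x x' 2)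

/-- The branching laminate, without boundary conditions. -/
noncomputable def laminate (h : ℝ) (x : E3) : ℝ :=
  branchProfile h (scale h (lateralDist (lateral x))) (frame.repr x 1)

theorem laminate_framePoint (h : ℝ) (p : ℝ × ℝ) (y : ℝ) :
    laminate h (framePoint p y) = branchProfile h (scale h (lateralDist p)) y := by
  simp [laminate, lateral_framePoint]

theorem abs_laminate_sub_le {h : ℝ} (hh : 0 < h) (x x' : E3) :
    |laminate h x - laminate h x'| ≤ 2 * ‖x - x'‖ := by
  have h1 := abs_branchProfile_sub_le h (scale h (lateralDist (lateral x)))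
    (scale h (lateralDist (lateral x'))) (frame.repr x 1) (frame.repr x' 1)
  have h2 := abs_scale_sub_le hh (lateralDist (lateral x)) (lateralDist (lateral x'))
  have h3 := abs_lateralDist_sub_le x x'
  have h4 := abs_repr_sub_le x x' 1
  unfold laminate
  linarith

theorem lipschitzWith_laminate {h : ℝ} (hh : 0 < h) : LipschitzWith 2 (laminate h) :=
  LipschitzWith.of_dist_le_mul fun x x' => by
    simpa [dist_eq_norm] using abs_laminate_sub_le hh x x'

theorem framePoint_sub_framePoint (p : ℝ × ℝ) (y y' : ℝ) :
    framePoint p y = framePoint p y' + (y - y') • b32 := by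
  rw [← framePoint_add]; ring_nf

theorem norm_b32 : ‖b32‖ = 1 := by rw [← frame_one]; exact frame.norm_eq_one 1

theorem lateral_add_smul_b32 (x : E3) (s : ℝ) : lateral (x + s • b32) = lateral x := by
  simp [lateral, ← frame_one]

theorem repr_one_add_smul_b32 (x : E3) (s : ℝ) :
    frame.repr (x + s • b32) 1 = frame.repr x 1 + s := by
  simp [← frame_one]

/-- Moving along `b32` leaves the scale unchanged, so the constant is 1 rather than 2, as
`lintegral_abs_sub_deriv_le` requires. -/
theorem abs_laminate_add_smul_b32_sub_le (h : ℝ) (x : E3) (s : ℝ) :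
    |laminate h (x + s • b32) - laminate h x| ≤ |s| := by
  have := abs_branchProfile_sub_le h (scale h (lateralDist (lateral x)))
    (scale h (lateralDist (lateral x))) (frame.repr x 1 + s) (frame.repr x 1)
  rw [add_sub_cancel_left, sub_self, abs_zero, zero_add] at this
  rwa [laminate, lateral_add_smul_b32, repr_one_add_smul_b32]

/-- The derivative of the laminate across the layers. -/
noncomputable def slope (h : ℝ) (x : E3) : ℝ := lineDeriv ℝ (laminate h) x b32

theorem measurable_slope {h : ℝ} (hh : 0 < h) : Measurable (slope h) :=
  measurable_lineDeriv (lipschitzWith_laminate hh).continuous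

theorem abs_slope_le (h : ℝ) (x : E3) : |slope h x| ≤ 1 := by
  refine norm_deriv_le_of_lip' (f := fun s : ℝ => laminate h (x + s • b32)) zero_le_one
    (Filter.Eventually.of_forall fun s => ?_)
  simpa using abs_laminate_add_smul_b32_sub_le h x s

theorem lipschitzWith_laminate_line (h : ℝ) (p : ℝ × ℝ) (c : E3) :
    LipschitzWith 1 fun y => laminate h (framePoint p y - c) :=
  LipschitzWith.of_dist_le_mul fun y y' => by
    have := abs_laminate_add_smul_b32_sub_le h (framePoint p y' - c) (y - y')
    rw [sub_add_eq_add_sub, ← framePoint_sub_framePoint] at this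
    simpa [Real.dist_eq] using this

theorem slope_framePoint_sub (h : ℝ) (p : ℝ × ℝ) (c : E3) (y : ℝ) :
    slope h (framePoint p y - c) = deriv (fun y => laminate h (framePoint p y - c)) y := by
  have h1 : (fun s : ℝ => laminate h (framePoint p y - c + s • b32)) =
      fun s => (fun y => laminate h (framePoint p y - c)) (y + s) := by
    ext s
    rw [sub_add_eq_add_sub, ← framePoint_add]
  have h2 := deriv_comp_const_add (fun y => laminate h (framePoint p y - c)) y 0
  rw [add_zero] at h2
  rw [slope, lineDeriv, h1, h2]

theorem lateralDist_le (p : ℝ × ℝ) : lateralDist p ≤ 1 :=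
  (min_le_left _ _).trans (by have := abs_nonneg p.1; linarith)

theorem slope_framePoint_of_affine {h : ℝ} {p : ℝ × ℝ} {l r c ς : ℝ}
    (hc : ∀ y ∈ Set.Icc l r, laminate h (framePoint p y) = c + ς * y) {y : ℝ}
    (hy : y ∈ Set.Ioo l r) : slope h (framePoint p y) = ς := by
  have h0 := slope_framePoint_sub h p 0 y
  simp only [sub_zero] at h0
  rw [h0]
  have h1 : (fun y => laminate h (framePoint p y)) =ᶠ[nhds y] fun y => c + ς * y := by
    filter_upwards [Ioo_mem_nhds hy.1 hy.2] with z hz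
    exact hc z (Set.Ioo_subset_Icc_self hz)
  rw [h1.deriv_eq]
  simp

theorem period_pos {h : ℝ} {m : ℕ} (hm : 0 < m) (hh : h = 1 / (2 * m)) : 0 < h := by
  have : (0 : ℝ) < m := by exact_mod_cast hm
  rw [hh]; positivity

theorem period_le_half {h : ℝ} {m : ℕ} (hm : 0 < m) (hh : h = 1 / (2 * m)) : h ≤ 1 / 2 := by
  have : (1 : ℝ) ≤ m := by exact_mod_cast hm
  rw [hh]
  gcongr
  linarith

theorem laminate_pieces {h : ℝ} {m : ℕ} (hm : 0 < m) (hh : h = 1 / (2 * m)) (p : ℝ × ℝ) :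
    ∃ (s : Finset ℤ) (l r c ς : ℤ × Fin 4 → ℝ),
      (s.card : ℝ) * 4 ≤ 8 / scale h (lateralDist p) ∧
      (∀ q, ς q = 1 ∨ ς q = -1) ∧
      (∀ q, ∀ y ∈ Set.Icc (l q) (r q), laminate h (framePoint p y) = c q + ς q * y) ∧
      Set.Ioo (-1 / 2 : ℝ) (1 / 2) ⊆ ⋃ q ∈ s ×ˢ (Finset.univ : Finset (Fin 4)),
        Set.Icc (l q) (r q) := by
  have h0 := period_pos hm hh
  have h1 := period_le_half hm hh
  simp_rw [laminate_framePoint]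
  exact branchProfile_pieces hm hh (scale_pos h0 _)
    (scale_le h0 (by linarith) (lateralDist_le p))

/-- No interface is located: the translated laminate stays `2 ‖c‖`-close to the original, so each
affine piece costs at most `4 ‖c‖`, and there are at most `8 / scale` pieces. -/
theorem lintegral_slope_sub_le {h : ℝ} {m : ℕ} (hm : 0 < m) (hh : h = 1 / (2 * m))
    (p : ℝ × ℝ) (c : E3) :
    ∫⁻ y in Set.Ioo (-1 / 2 : ℝ) (1 / 2),
      ENNReal.ofReal |slope h (framePoint p y) - slope h (framePoint p y - c)| ≤
      ENNReal.ofReal (32 * ‖c‖ / scale h (lateralDist p)) := by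
  have h0 := period_pos hm hh
  obtain ⟨s, l, r, a, ς, hcard, hς, haff, hcov⟩ := laminate_pieces hm hh p
  have hpiece : ∀ q, ∫⁻ y in Set.Icc (l q) (r q),
      ENNReal.ofReal |slope h (framePoint p y) - slope h (framePoint p y - c)| ≤
        ENNReal.ofReal (4 * ‖c‖) := by
    intro q
    have h1 := lintegral_abs_sub_deriv_le (lipschitzWith_laminate_line h p c) (l := l q) (r := r q)
      (c := a q) (hς q) (η := 2 * ‖c‖) (fun y hy => by
        rw [← haff q y hy]
        simpa using abs_laminate_sub_le h0 (framePoint p y) (framePoint p y - c))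
    rw [show 4 * ‖c‖ = 2 * (2 * ‖c‖) by ring]
    refine le_trans (le_of_eq ?_) h1
    rw [← restrict_Ioo_eq_restrict_Icc]
    refine setLIntegral_congr_fun measurableSet_Ioo fun y hy => ?_
    rw [slope_framePoint_sub, slope_framePoint_of_affine (haff q) hy]
  calc _ ≤ ∫⁻ y in ⋃ q ∈ s ×ˢ (Finset.univ : Finset (Fin 4)), Set.Icc (l q) (r q),
        ENNReal.ofReal |slope h (framePoint p y) - slope h (framePoint p y - c)| :=
        lintegral_mono_set hcov
    _ ≤ ∑ q ∈ s ×ˢ (Finset.univ : Finset (Fin 4)), ∫⁻ y in Set.Icc (l q) (r q),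
        ENNReal.ofReal |slope h (framePoint p y) - slope h (framePoint p y - c)| := by
        rw [← Finset.set_biUnion_coe, Set.biUnion_eq_iUnion]
        refine (lintegral_iUnion_le _ _).trans (le_of_eq ?_)
        rw [tsum_fintype]
        exact Finset.sum_coe_sort (s ×ˢ (Finset.univ : Finset (Fin 4))) fun q =>
          ∫⁻ y in Set.Icc (l q) (r q),
            ENNReal.ofReal |slope h (framePoint p y) - slope h (framePoint p y - c)|
    _ ≤ ∑ q ∈ s ×ˢ (Finset.univ : Finset (Fin 4)), ENNReal.ofReal (4 * ‖c‖) :=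
        Finset.sum_le_sum fun q _ => hpiece q
    _ = ENNReal.ofReal (s.card * 4 * (4 * ‖c‖)) := by
        rw [Finset.sum_const, Finset.card_product, Finset.card_univ, Fintype.card_fin,
          nsmul_eq_mul, ← ENNReal.ofReal_natCast, ← ENNReal.ofReal_mul (by positivity)]
        push_cast
        rfl
    _ ≤ _ := by
        apply ENNReal.ofReal_le_ofReal
        have : 32 * ‖c‖ / scale h (lateralDist p) = 8 / scale h (lateralDist p) * (4 * ‖c‖) := by
          ring
        rw [this]
        gcongr

/-! ### The weight and the total variation of the slope -/

/-- The singular weight controlling both the elastic and the surface energy density. -/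
noncomputable def weight (p : ℝ × ℝ) : ℝ≥0∞ := ENNReal.ofReal (lateralDist p ^ (-2 / 3 : ℝ))

theorem measurable_weight : Measurable weight := by
  unfold weight lateralDist
  fun_prop

/-- The open unit square. -/
abbrev square : Set (ℝ × ℝ) := Set.Ioo (-1 / 2 : ℝ) (1 / 2) ×ˢ Set.Ioo (-1 / 2 : ℝ) (1 / 2)

theorem lateralDist_pos {p : ℝ × ℝ} (hp : p ∈ square) : 0 < lateralDist p := by
  obtain ⟨⟨h1, h2⟩, h3, h4⟩ := hp
  have h5 : |p.1| < 1 / 2 := abs_lt.2 ⟨by linarith, h2⟩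
  have h6 : |p.2| < 1 / 2 := abs_lt.2 ⟨by linarith, h4⟩
  exact lt_min (by linarith) (by linarith)

/-- The minimum is one of the two distances, so the weight is at most the sum of two one-variable
powers, integrable since `-2/3 > -1`. -/
theorem lintegral_weight_lt_top : ∫⁻ p in square, weight p < ∞ := by
  have hp : ∫⁻ z in Set.Ioo (-1 / 2 : ℝ) (1 / 2),
      ENNReal.ofReal ((1 / 2 - |z|) ^ (-2 / 3 : ℝ)) < ∞ := by
    have h1 : IntervalIntegrable (fun z : ℝ => (1 / 2 - z) ^ (-2 / 3 : ℝ))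
        volume (-1 / 2) (1 / 2) := by
      have := (intervalIntegral.intervalIntegrable_rpow' (a := 1) (b := 0) (r := (-2 / 3 : ℝ))
        (by norm_num)).comp_sub_left (1 / 2)
      convert this using 1 <;> norm_num
    have h2 : IntervalIntegrable (fun z : ℝ => (1 / 2 + z) ^ (-2 / 3 : ℝ))
        volume (-1 / 2) (1 / 2) := by
      have := (intervalIntegral.intervalIntegrable_rpow' (a := 0) (b := 1) (r := (-2 / 3 : ℝ))
        (by norm_num)).comp_add_left (1 / 2)
      convert this using 1 <;> norm_num
    have h3 := h1.add h2
    rw [intervalIntegrable_iff_integrableOn_Ioo_of_le (by norm_num)] at h3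
    refine lt_of_le_of_lt (setLIntegral_mono' measurableSet_Ioo fun z hz => ?_) h3.lintegral_lt_top
    apply ENNReal.ofReal_le_ofReal
    have e1 : 0 ≤ (1 / 2 - z) ^ (-2 / 3 : ℝ) := Real.rpow_nonneg (by linarith [hz.2]) _
    have e2 : 0 ≤ (1 / 2 + z) ^ (-2 / 3 : ℝ) := Real.rpow_nonneg (by linarith [hz.1]) _
    rcases abs_cases z with ⟨h, -⟩ | ⟨h, -⟩
    · rw [h]; exact le_add_of_nonneg_right e2
    · rw [h, sub_neg_eq_add]; exact le_add_of_nonneg_left e1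
  set f : ℝ → ℝ≥0∞ := fun z => ENNReal.ofReal ((1 / 2 - |z|) ^ (-2 / 3 : ℝ)) with hf
  have hfm : Measurable f := by unfold f; fun_prop
  have hle : ∀ p ∈ square, weight p ≤ f p.1 + f p.2 := by
    intro p hp
    rcases min_choice (1 / 2 - |p.1|) (1 / 2 - |p.2|) with h | h
    · rw [weight, lateralDist, h]; exact le_self_add
    · rw [weight, lateralDist, h]; exact le_add_self
  refine lt_of_le_of_lt (setLIntegral_mono' (measurableSet_Ioo.prod measurableSet_Ioo) hle) ?_
  rw [lintegral_add_left (f := fun p : ℝ × ℝ => f p.1) (hfm.comp measurable_fst)]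
  rw [Measure.volume_eq_prod, ← Measure.prod_restrict, lintegral_prod _ (by fun_prop),
    lintegral_prod _ (by fun_prop)]
  simp only [lintegral_const, Measure.restrict_apply MeasurableSet.univ, Set.univ_inter,
    Real.volume_Ioo]
  norm_num
  rw [← neg_div]
  exact hp

theorem measurableSet_square : MeasurableSet square := measurableSet_Ioo.prod measurableSet_Ioo

theorem continuous_lateral : Continuous lateral := by
  unfold lateral
  fun_prop

theorem lintegral_weight_Ω :
    ∫⁻ x in Ω, weight (lateral x) = ∫⁻ p in square, weight p := by
  rw [lintegral_Ω (f := fun x => weight (lateral x))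
    (measurable_weight.comp continuous_lateral.measurable)]
  simp only [lateral_framePoint, lintegral_const, Measure.restrict_apply MeasurableSet.univ,
    Set.univ_inter, Real.volume_Ioo]
  norm_num
  rw [← neg_div]

theorem lintegral_Ω_slope_sub_le {h : ℝ} {m : ℕ} (hm : 0 < m) (hh : h = 1 / (2 * m)) (c : E3) :
    ∫⁻ x in Ω, ENNReal.ofReal |slope h x - slope h (x - c)| ≤
      ENNReal.ofReal (32 * ‖c‖ / h) * ∫⁻ p in square, weight p := by
  have h0 := period_pos hm hh
  have hs := measurable_slope h0
  rw [lintegral_Ω (by fun_prop), ← lintegral_const_mul _ measurable_weight]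
  refine setLIntegral_mono' measurableSet_square fun p hp => ?_
  refine (lintegral_slope_sub_le hm hh p c).trans ?_
  have hr := lateralDist_pos hp
  rw [weight, ← ENNReal.ofReal_mul (by positivity)]
  apply ENNReal.ofReal_le_ofReal
  calc 32 * ‖c‖ / scale h (lateralDist p) ≤ 32 * ‖c‖ / (h * lateralDist p ^ (2 / 3 : ℝ)) := by
        gcongr
        exact le_scale h0 hr
    _ = _ := by
        rw [neg_div, Real.rpow_neg hr.le]
        field_simp

/-- On each line along `b32` only the finitely many endpoints of pieces can be exceptional. -/
theorem slope_eq_one_or_neg_one {h : ℝ} {m : ℕ} (hm : 0 < m) (hh : h = 1 / (2 * m)) :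
    ∀ᵐ x ∂volume.restrict Ω, slope h x = 1 ∨ slope h x = -1 := by
  have h0 := period_pos hm hh
  have hs := measurable_slope h0
  set B : Set E3 := {x | ¬(slope h x = 1 ∨ slope h x = -1)} with hB
  have hBm : MeasurableSet B :=
    ((measurableSet_eq_fun hs measurable_const).union
      (measurableSet_eq_fun hs measurable_const)).compl
  rw [ae_iff, ← hB, ← lintegral_indicator_one hBm, lintegral_Ω (measurable_one.indicator hBm)]
  refine (lintegral_congr fun p => ?_).trans lintegral_zero
  obtain ⟨s, l, r, a, ς, -, hς, haff, hcov⟩ := laminate_pieces hm hh p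
  have hfin : (⋃ q ∈ s ×ˢ (Finset.univ : Finset (Fin 4)), {l q, r q}).Finite :=
    Set.Finite.biUnion (Finset.finite_toSet _) fun q _ => by simp
  refine lintegral_eq_zero_of_ae_eq_zero ?_
  rw [Filter.EventuallyEq, ae_restrict_iff' measurableSet_Ioo]
  filter_upwards [hfin.measure_zero volume |> compl_mem_ae_iff.2] with y hy hyI
  obtain ⟨q, hq, hyq⟩ := Set.mem_iUnion₂.1 (hcov hyI)
  have hne : y ≠ l q ∧ y ≠ r q := by
    constructor <;> rintro rfl <;> exact hy (Set.mem_iUnion₂.2 ⟨q, hq, by simp⟩)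
  have hyo : y ∈ Set.Ioo (l q) (r q) :=
    ⟨lt_of_le_of_ne hyq.1 hne.1.symm, lt_of_le_of_ne hyq.2 hne.2⟩
  have := slope_framePoint_of_affine (haff q) hyo
  simp only [hB, Set.indicator_apply, Set.mem_ofPred_eq, this, hς q, not_true_eq_false, if_false,
    Pi.zero_apply]

theorem norm_lt_one_of_mem_Ω {x : E3} (hx : x ∈ Ω) : ‖x‖ < 1 := by
  rw [mem_Ω_iff] at hx
  rw [← frame.repr.norm_map, EuclideanSpace.norm_eq, Fin.sum_univ_three, Real.sqrt_lt' one_pos]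
  simp only [Real.norm_eq_abs]
  have h0 := pow_lt_pow_left₀ (hx 0) (abs_nonneg _) two_ne_zero
  have h1 := pow_lt_pow_left₀ (hx 1) (abs_nonneg _) two_ne_zero
  have h2 := pow_lt_pow_left₀ (hx 2) (abs_nonneg _) two_ne_zero
  linarith

theorem volume_Ω_lt_top : volume Ω < ∞ :=
  (measure_mono fun x hx => by simpa using norm_lt_one_of_mem_Ω hx).trans_lt
    (measure_ball_lt_top (x := (0 : E3)) (r := 1))

/-- The total variation of the slope in the direction `v`, tested against one function. -/
theorem abs_integral_slope_mul_lineDeriv_le {h : ℝ} {m : ℕ} (hm : 0 < m)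
    (hh : h = 1 / (2 * m)) {ψ : E3 → ℝ} (hψ : ContDiff ℝ 1 ψ) (hc : HasCompactSupport ψ)
    (hsupp : tsupport ψ ⊆ Ω) (hb : ∀ x, |ψ x| ≤ 1) {v : E3} (hv : ‖v‖ ≤ 1) :
    |∫ x in Ω, slope h x * lineDeriv ℝ ψ x v| ≤ 32 / h * (∫⁻ p in square, weight p).toReal := by
  have h0 := period_pos hm hh
  have hs := measurable_slope h0
  obtain ⟨C, hC⟩ := hψ.lipschitzWith_of_hasCompactSupport hc one_ne_zero
  -- Truncation makes the slope integrable; radius 2 leaves it unchanged on `Ω` and on its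
  -- translates by vectors shorter than 1.
  set g : E3 → ℝ := (Metric.ball (0 : E3) 2).indicator (slope h) with hg
  have hgi : Integrable g := by
    rw [hg, integrable_indicator_iff Metric.isOpen_ball.measurableSet]
    exact Measure.integrableOn_of_bounded (M := 1) measure_ball_lt_top.ne hs.aestronglyMeasurable
      (Filter.Eventually.of_forall fun x => abs_slope_le h x)
  have hout : ∀ x, x ∉ Ω → ψ x = 0 := fun x hx => image_eq_zero_of_notMem_tsupport fun hx' =>
    hx (hsupp hx')
  have hout' : ∀ x, x ∉ Ω → lineDeriv ℝ ψ x v = 0 := fun x hx => by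
    rw [(hψ.differentiable one_ne_zero x).lineDeriv_eq_fderiv,
      image_eq_zero_of_notMem_tsupport fun hx' => hx (hsupp (tsupport_fderiv_subset ℝ hx'))]
    rfl
  have hgΩ : ∀ x ∈ Ω, g x = slope h x := fun x hx =>
    Set.indicator_of_mem (by simpa using (norm_lt_one_of_mem_Ω hx).trans one_lt_two) _
  have hint : ∫ x in Ω, slope h x * lineDeriv ℝ ψ x v = ∫ x, lineDeriv ℝ ψ x v * g x := by
    refine (setIntegral_congr_fun isOpen_Ω.measurableSet fun x hx => ?_).trans
      (setIntegral_eq_integral_of_forall_compl_eq_zero fun x hx => by rw [hout' x hx, zero_mul])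
    rw [hgΩ x hx, mul_comm]
  have hlim := hC.integral_inv_smul_sub_mul_tendsto_integral_lineDeriv_mul hgi v
  rw [hint]
  refine le_of_tendsto hlim.abs ?_
  filter_upwards [Ioo_mem_nhdsGT (show (0 : ℝ) < 1 by norm_num)] with t ht
  have ht0 : 0 < t := ht.1
  have hψi : Integrable ψ := hψ.continuous.integrable_of_hasCompactSupport hc
  have hgb : ∀ x, ‖g x‖ ≤ 1 := fun x =>
    (norm_indicator_le_norm_self _ _).trans (abs_slope_le h x)
  have hgm : AEStronglyMeasurable g := hgi.aestronglyMeasurable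
  have hgm' : Measurable g := hs.indicator Metric.isOpen_ball.measurableSet
  have hi1 : Integrable fun x => ψ x * g x := hψi.mul_bdd hgm (Filter.Eventually.of_forall hgb)
  have hi2 : Integrable fun x => ψ x * g (x - t • v) :=
    hψi.mul_bdd (hgm'.comp (measurable_id.sub_const _)).aestronglyMeasurable
      (Filter.Eventually.of_forall fun x => hgb _)
  -- Discrete integration by parts: the difference quotient moves from `ψ` to the slope.
  have hshift : ∫ x, ψ (x + t • v) * g x = ∫ x, ψ x * g (x - t • v) := by
    rw [← integral_add_right_eq_self (fun x => ψ x * g (x - t • v)) (t • v)]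
    simp
  have hi3 : Integrable fun x => ψ (x + t • v) * g x := by
    have := hi2.comp_add_right (t • v)
    simpa using this
  have hnorm : ‖t • v‖ ≤ t := by
    rw [norm_smul, Real.norm_eq_abs, abs_of_pos ht0]
    nlinarith
  have hmain : ‖∫ x in Ω, ψ x * (g (x - t • v) - g x)‖ ≤
      32 * t / h * (∫⁻ p in square, weight p).toReal := by
    refine (norm_integral_le_lintegral_norm _).trans ?_
    refine ENNReal.toReal_le_of_le_ofReal (by positivity) ?_
    rw [ENNReal.ofReal_mul (by positivity), ENNReal.ofReal_toReal lintegral_weight_lt_top.ne]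
    calc _ ≤ ∫⁻ x in Ω, ENNReal.ofReal |slope h x - slope h (x - t • v)| := by
          refine setLIntegral_mono' isOpen_Ω.measurableSet fun x hx => ?_
          apply ENNReal.ofReal_le_ofReal
          have hx' : x - t • v ∈ Metric.ball (0 : E3) 2 := by
            rw [mem_ball_zero_iff]
            have := norm_sub_le x (t • v)
            have := norm_lt_one_of_mem_Ω hx
            linarith [ht.2]
          rw [hgΩ x hx, hg, Set.indicator_of_mem hx', norm_mul, Real.norm_eq_abs, Real.norm_eq_abs,
            abs_sub_comm]
          exact mul_le_of_le_one_left (abs_nonneg _) (hb x)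
      _ ≤ ENNReal.ofReal (32 * ‖t • v‖ / h) * ∫⁻ p in square, weight p :=
          lintegral_Ω_slope_sub_le hm hh _
      _ ≤ _ := by gcongr
  have hrw : ∫ x, (t⁻¹ • (ψ (x + t • v) - ψ x)) * g x =
      t⁻¹ * ∫ x in Ω, ψ x * (g (x - t • v) - g x) := by
    rw [setIntegral_eq_integral_of_forall_compl_eq_zero
      (fun x hx => by rw [hout x hx, zero_mul])]
    simp only [smul_eq_mul, mul_assoc, mul_sub, sub_mul]
    rw [integral_sub (hi3.const_mul _) (hi1.const_mul _), integral_const_mul, integral_const_mul,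
      hshift, integral_sub hi2 hi1, mul_sub]
  rw [hrw, abs_mul, abs_of_pos (inv_pos.2 ht0), ← Real.norm_eq_abs]
  calc t⁻¹ * _ ≤ t⁻¹ * (32 * t / h * (∫⁻ p in square, weight p).toReal) := by gcongr
    _ = _ := by field_simp

/-! ### The phase indicator and its surface energy -/

/-- The phase indicator of the branching construction. -/
noncomputable def phase (h : ℝ) (x : E3) : M3 :=
  open scoped Classical in if 0 < slope h x then e2 else e3

theorem phase_mem (h : ℝ) (x : E3) : phase h x ∈ ({e2, e3} : Set M3) := by
  unfold phase
  split_ifs <;> simp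

theorem measurable_phase {h : ℝ} (hh : 0 < h) (i j : Fin 3) :
    Measurable fun x => phase h x i j := by
  have : (fun x => phase h x i j) = fun x =>
      (open scoped Classical in if 0 < slope h x then e2 i j else e3 i j) := by
    ext x; unfold phase; split_ifs <;> rfl
  rw [this]
  exact Measurable.ite (measurableSet_lt measurable_const (measurable_slope hh))
    measurable_const measurable_const

/-- Since `e2` and `e3` are symmetric about `F`, the phase is affine in the slope, which reduces its
variation to that of a scalar. -/
theorem phase_eq {h : ℝ} {x : E3} (hx : slope h x = 1 ∨ slope h x = -1) (i j : Fin 3) :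
    phase h x i j = F i j + (e2 - F) i j * slope h x := by
  rcases hx with hx | hx
  · simp [phase, hx]
  · rw [phase, if_neg (by rw [hx]; norm_num), hx]
    simp [F]
    ring

theorem abs_phase_le (h : ℝ) (x : E3) (i j : Fin 3) : |phase h x i j| ≤ 2 := by
  unfold phase
  split_ifs <;> fin_cases i <;> fin_cases j <;> norm_num [e2, e3]

theorem integral_lineDeriv_eq_zero {ψ : E3 → ℝ} (hψ : ContDiff ℝ 1 ψ) (hc : HasCompactSupport ψ)
    (v : E3) : ∫ x, lineDeriv ℝ ψ x v = 0 := by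
  obtain ⟨C, hC⟩ := hψ.lipschitzWith_of_hasCompactSupport hc one_ne_zero
  have := (LipschitzWith.const (1 : ℝ)).integral_lineDeriv_mul_eq (μ := (volume : Measure E3))
    hC hc (-v)
  simpa [lineDeriv] using this.symm

theorem surfaceEnergy_phase_le {h : ℝ} {m : ℕ} (hm : 0 < m) (hh : h = 1 / (2 * m)) :
    surfaceEnergy Ω (phase h) ≤
      ENNReal.ofReal (2000 / h * (∫⁻ p in square, weight p).toReal) := by
  have h0 := period_pos hm hh
  refine iSup₂_le fun φ ⟨hφ, hφ1⟩ => ENNReal.ofReal_le_ofReal ?_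
  set T := 32 / h * (∫⁻ p in square, weight p).toReal with hT
  have hT0 : 0 ≤ T := by positivity
  have hle : ∀ i j k x, |φ i j k x| ≤ 1 := fun i j k x => by
    rw [← sq_le_one_iff_abs_le_one]
    refine le_trans ?_ (hφ1 x)
    refine le_trans ?_ (Finset.single_le_sum (fun i _ => by positivity) (Finset.mem_univ i))
    refine le_trans ?_ (Finset.single_le_sum (fun i _ => by positivity) (Finset.mem_univ j))
    exact Finset.single_le_sum (f := fun k => φ i j k x ^ 2) (fun i _ => by positivity)
      (Finset.mem_univ k)
  have hpd : ∀ i j k x, pderiv k (φ i j k) x = lineDeriv ℝ (φ i j k) x (EuclideanSpace.single k 1) :=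
    fun i j k x => ((((hφ i j k).1.differentiable one_ne_zero) x).lineDeriv_eq_fderiv).symm
  have hder : ∀ i j k, Continuous fun x => pderiv k (φ i j k) x := fun i j k =>
    ((hφ i j k).1.continuous_fderiv one_ne_zero).clm_apply continuous_const
  have hderc : ∀ i j k, HasCompactSupport fun x => pderiv k (φ i j k) x := fun i j k =>
    (hφ i j k).2.1.fderiv_apply (𝕜 := ℝ) _
  have hint : ∀ i j k, IntegrableOn (fun x => pderiv k (φ i j k) x) Ω := fun i j k =>
    ((hder i j k).integrable_of_hasCompactSupport (hderc i j k)).integrableOn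
  have hints : ∀ i j k, IntegrableOn (fun x => slope h x * pderiv k (φ i j k) x) Ω :=
    fun i j k => (hint i j k).bdd_mul (measurable_slope h0).aestronglyMeasurable
      (Filter.Eventually.of_forall fun x => abs_slope_le h x)
  have hintp : ∀ i j k, IntegrableOn (fun x => phase h x i j * pderiv k (φ i j k) x) Ω :=
    fun i j k => (hint i j k).bdd_mul (measurable_phase h0 i j).aestronglyMeasurable
      (Filter.Eventually.of_forall fun x => abs_phase_le h x i j)
  have hterm : ∀ i j k, ∫ x in Ω, phase h x i j * pderiv k (φ i j k) x ≤ 2 * T := by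
    intro i j k
    have e1 : ∫ x in Ω, phase h x i j * pderiv k (φ i j k) x =
        F i j * (∫ x in Ω, pderiv k (φ i j k) x) +
          (e2 - F) i j * ∫ x in Ω, slope h x * pderiv k (φ i j k) x := by
      rw [← integral_const_mul, ← integral_const_mul,
        ← integral_add ((hint i j k).const_mul _) ((hints i j k).const_mul _)]
      refine integral_congr_ae ?_
      filter_upwards [slope_eq_one_or_neg_one hm hh] with x hx
      rw [phase_eq hx]
      ring
    have e2' : ∫ x in Ω, pderiv k (φ i j k) x = 0 := by
      rw [setIntegral_eq_integral_of_forall_compl_eq_zero]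
      · simp_rw [hpd]
        exact integral_lineDeriv_eq_zero (hφ i j k).1 (hφ i j k).2.1 _
      · intro x hx
        rw [pderiv, image_eq_zero_of_notMem_tsupport fun hx' =>
          hx ((hφ i j k).2.2 (tsupport_fderiv_subset ℝ hx'))]
        rfl
    have e3' := abs_integral_slope_mul_lineDeriv_le hm hh (hφ i j k).1 (hφ i j k).2.1
      (hφ i j k).2.2 (hle i j k) (v := EuclideanSpace.single k 1) (by simp)
    simp_rw [← hpd] at e3'
    rw [e1, e2', mul_zero, zero_add]
    refine (le_abs_self _).trans ?_
    rw [abs_mul]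
    have e4 : |(e2 - F) i j| ≤ 2 := by
      fin_cases i <;> fin_cases j <;> norm_num [e2, F, e3, abs_le]
    gcongr
  have hsum : ∫ x in Ω, ∑ i, ∑ j, ∑ k, phase h x i j * pderiv k (φ i j k) x =
      ∑ i, ∑ j, ∑ k, ∫ x in Ω, phase h x i j * pderiv k (φ i j k) x := by
    rw [integral_finsetSum _ fun i _ => integrable_finsetSum _ fun j _ =>
      integrable_finsetSum _ fun k _ => hintp i j k]
    refine Finset.sum_congr rfl fun i _ => ?_
    rw [integral_finsetSum _ fun j _ => integrable_finsetSum _ fun k _ => hintp i j k]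
    exact Finset.sum_congr rfl fun j _ => integral_finsetSum _ fun k _ => hintp i j k
  rw [hsum]
  -- There are 27 components, each at most `2 * T`, and `54 * 32 = 1728 ≤ 2000`.
  calc _ ≤ ∑ _i : Fin 3, ∑ _j : Fin 3, ∑ _k : Fin 3, 2 * T :=
        Finset.sum_le_sum fun i _ => Finset.sum_le_sum fun j _ => Finset.sum_le_sum fun k _ =>
          hterm i j k
    _ = 54 * T := by simp; ring
    _ ≤ _ := by
        rw [hT, ← mul_assoc]
        gcongr
        rw [mul_div_assoc']
        gcongr
        norm_num

theorem memBV_phase {h : ℝ} {m : ℕ} (hm : 0 < m) (hh : h = 1 / (2 * m)) :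
    MemBV Ω {e2, e3} (phase h) := by
  refine ⟨fun i j => ?_, Filter.Eventually.of_forall (phase_mem h),
    (surfaceEnergy_phase_le hm hh).trans_lt ENNReal.ofReal_lt_top⟩
  exact Measure.integrableOn_of_bounded (M := 2) volume_Ω_lt_top.ne
    (measurable_phase (period_pos hm hh) i j).aestronglyMeasurable
    (Filter.Eventually.of_forall fun x => abs_phase_le h x i j)

/-! ### The cut-off and its gradient -/

theorem branchProfile_le_self {h a : ℝ} (hh : 0 < h) (ha : 0 < a) (y : ℝ) :
    branchProfile h a y ≤ a := by
  obtain ⟨i, hi⟩ := exists_pow_lt_of_lt_one (div_pos ha hh) (show (1 / 2 : ℝ) < 1 by norm_num)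
  have hi' : h / 2 ^ i ≤ a := by
    rw [lt_div_iff₀ hh, div_pow, one_pow] at hi
    rw [← one_div_mul_eq_div]
    exact hi.le
  have hp : 0 < h / 2 ^ i := by positivity
  refine (branchProfile_le h a y i (round (y / (h / 2 ^ i)))).trans ?_
  rw [max_eq_right (by linarith)]
  set H := h / 2 ^ i
  have h1 : |y - round (y / H) * H| ≤ 1 / 2 * H := by
    have : y - round (y / H) * H = (y / H - round (y / H)) * H := by field_simp
    rw [this, abs_mul, abs_of_pos hp]
    gcongr
    exact abs_sub_round _
  linarith

/-- The faces `y = ±1/2 = ±m h` lie on the coarsest grid, which is free of penalty for `a ≤ h`. So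
the profile vanishes there without a cut-off. -/
theorem branchProfile_le_sub_abs {h a y : ℝ} {m : ℕ} (hm : 0 < m) (hh : h = 1 / (2 * m))
    (ha : a ≤ h) (hy : |y| ≤ 1 / 2) : branchProfile h a y ≤ 1 / 2 - |y| := by
  have hmR : (0 : ℝ) < m := by exact_mod_cast hm
  have hmh : (m : ℝ) * h = 1 / 2 := by rw [hh]; field_simp
  rw [abs_le] at hy
  rcases le_total 0 y with h0 | h0
  · refine (branchProfile_le h a y 0 m).trans ?_
    rw [pow_zero, div_one, max_eq_left (by linarith), add_zero, Int.cast_natCast, hmh,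
      abs_of_nonneg h0, abs_of_nonpos (by linarith)]
    linarith
  · refine (branchProfile_le h a y 0 (-m)).trans ?_
    rw [pow_zero, div_one, max_eq_left (by linarith), add_zero]
    push_cast
    rw [neg_mul, hmh, abs_of_nonpos h0, abs_of_nonneg (by linarith)]
    linarith

/-- The branching laminate, cut off by the distance to the boundary of `Ω`. -/
noncomputable def cutLaminate (h : ℝ) (x : E3) : ℝ :=
  max 0 (min (laminate h x) (min (lateralDist (lateral x)) (1 / 2 - |frame.repr x 1|)))

theorem lipschitzWith_cutLaminate {h : ℝ} (hh : 0 < h) : LipschitzWith 2 (cutLaminate h) := by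
  refine LipschitzWith.of_dist_le_mul fun x x' => ?_
  rw [Real.dist_eq, dist_eq_norm]
  have h0 := norm_nonneg (x - x')
  refine (abs_max_sub_max_le_max _ _ _ _).trans (max_le (by simp) ?_)
  refine (abs_min_sub_min_le_max _ _ _ _).trans
    (max_le (by simpa using abs_laminate_sub_le hh x x') ?_)
  refine (abs_min_sub_min_le_max _ _ _ _).trans (max_le ?_ ?_)
  · have := abs_lateralDist_sub_le x x'
    push_cast
    linarith
  · rw [sub_sub_sub_cancel_left, abs_sub_comm]
    have := (abs_abs_sub_abs_le _ _).trans (abs_repr_sub_le x x' 1)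
    push_cast
    linarith

theorem cutLaminate_of_notMem {h : ℝ} {x : E3} (hx : x ∉ Ω) : cutLaminate h x = 0 := by
  refine max_eq_left ((min_le_right _ _).trans ?_)
  rw [mem_Ω_iff] at hx
  push Not at hx
  obtain ⟨i, hi⟩ := hx
  fin_cases i
  · exact (min_le_left _ _).trans ((min_le_left _ _).trans (sub_nonpos.2 hi))
  · exact (min_le_right _ _).trans (sub_nonpos.2 hi)
  · exact (min_le_left _ _).trans ((min_le_right _ _).trans (sub_nonpos.2 hi))

theorem cutLaminate_eq_laminate {h : ℝ} {m : ℕ} (hm : 0 < m) (hh : h = 1 / (2 * m)) {x : E3}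
    (hx : x ∈ Ω) (hx' : h ^ 3 ≤ lateralDist (lateral x)) : cutLaminate h x = laminate h x := by
  have h0 := period_pos hm hh
  have h1 := period_le_half hm hh
  rw [cutLaminate, min_eq_left, max_eq_right]
  · exact branchProfile_nonneg _ _ _
  · refine le_min ?_ ?_
    · exact (branchProfile_le_self h0 (scale_pos h0 _) _).trans (scale_le_self h0 hx')
    · exact branchProfile_le_sub_abs hm hh (scale_le h0 (by linarith) (lateralDist_le _))
        ((mem_Ω_iff x).1 hx 1).le

theorem lateral_mem_square {x : E3} (hx : x ∈ Ω) : lateral x ∈ square := by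
  rw [mem_Ω_iff] at hx
  have h0 := abs_lt.1 (hx 0)
  have h2 := abs_lt.1 (hx 2)
  exact ⟨⟨by rw [neg_div]; exact h0.1, h0.2⟩, ⟨by rw [neg_div]; exact h2.1, h2.2⟩⟩

/-- Tangentially to the layers, the laminate varies slowly. -/
theorem abs_lineDeriv_laminate_le {h : ℝ} (hh : 0 < h) {x : E3}
    (hx : 0 < lateralDist (lateral x)) {i : Fin 3} (hi : i ≠ 1) :
    |lineDeriv ℝ (laminate h) x (frame i)| ≤
      2 * h * lateralDist (lateral x) ^ (-1 / 3 : ℝ) := by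
  set ρ := lateralDist (lateral x) with hρ
  -- A fraction of `ρ` bounds the distance below at nearby points; `1/8` has an exact cube root.
  have hρ8 : (ρ / 8) ^ (-1 / 3 : ℝ) = 2 * ρ ^ (-1 / 3 : ℝ) := by
    rw [Real.div_rpow hx.le (by norm_num), show (8 : ℝ) = 2 ^ 3 by norm_num,
      cube_rpow_neg_one_third two_pos]
    field_simp
  refine norm_deriv_le_of_lip' (f := fun s : ℝ => laminate h (x + s • frame i)) (by positivity) ?_
  have hcont : ContinuousAt (fun s : ℝ => lateralDist (lateral (x + s • frame i))) 0 := by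
    unfold lateralDist lateral
    fun_prop
  have hev := hcont.eventually_const_lt (u := ρ / 8) (by simp only [zero_smul, add_zero]; linarith)
  filter_upwards [hev] with s hs
  have h1 : frame.repr (x + s • frame i) 1 = frame.repr x 1 := by
    simp [hi.symm]
  have h2 := abs_scale_sub_le_of_le (h := h) (s := ρ / 8) hh (by positivity)
    (le_max_of_le_left hs.le) (le_max_of_le_left (show ρ / 8 ≤ ρ by linarith))
  have h3 := abs_lateralDist_sub_le (x + s • frame i) x
  rw [add_sub_cancel_left, norm_smul, frame.norm_eq_one, mul_one] at h3
  have h4 := abs_branchProfile_sub_le h (scale h (lateralDist (lateral (x + s • frame i))))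
    (scale h ρ) (frame.repr x 1) (frame.repr x 1)
  rw [sub_self, abs_zero, add_zero] at h4
  simp only [zero_smul, add_zero, sub_zero]
  rw [laminate, laminate, h1, Real.norm_eq_abs]
  calc _ ≤ _ := h4
    _ ≤ _ := h2
    _ ≤ h * (ρ / 8) ^ (-1 / 3 : ℝ) * ‖s‖ := by gcongr
    _ = _ := by rw [hρ8]; ring

/-- The squared distance of the gradient of the cut laminate to `± b₃₂` is controlled by the
weight. -/
theorem sum_sq_fderiv_cutLaminate_le {h : ℝ} {m : ℕ} (hm : 0 < m) (hh : h = 1 / (2 * m)) {x : E3}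
    (hx : x ∈ Ω) (hd : DifferentiableAt ℝ (cutLaminate h) x) :
    (fderiv ℝ (cutLaminate h) x nVec) ^ 2 + (fderiv ℝ (cutLaminate h) x b32 - slope h x) ^ 2 +
      (fderiv ℝ (cutLaminate h) x dVec) ^ 2 ≤
      17 * h ^ 2 * lateralDist (lateral x) ^ (-2 / 3 : ℝ) := by
  have h0 := period_pos hm hh
  have hρ := lateralDist_pos (lateral_mem_square hx)
  set ρ := lateralDist (lateral x) with hρdef
  have hsq : ρ ^ (-2 / 3 : ℝ) = (ρ ^ (-1 / 3 : ℝ)) ^ 2 := by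
    rw [← Real.rpow_natCast, ← Real.rpow_mul hρ.le]; norm_num
  set L := fderiv ℝ (cutLaminate h) x
  rcases lt_or_ge (h ^ 3) ρ with hlt | hge
  -- The strict inequality keeps the cut-off inactive in a neighbourhood, so only tangential terms
  -- survive.
  · have hcont : Continuous fun x => lateralDist (lateral x) := by
      unfold lateralDist lateral
      fun_prop
    have heq : cutLaminate h =ᶠ[nhds x] laminate h := by
      filter_upwards [isOpen_Ω.mem_nhds hx, (isOpen_lt continuous_const hcont).mem_nhds hlt]
        with z hz hz'
      exact cutLaminate_eq_laminate hm hh hz (le_of_lt hz')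
    have hL : ∀ v, L v = lineDeriv ℝ (laminate h) x v := fun v => by
      rw [← hd.lineDeriv_eq_fderiv, heq.lineDeriv_eq]
    have hb : ∀ i : Fin 3, i ≠ 1 → L (frame i) ^ 2 ≤ 4 * h ^ 2 * ρ ^ (-2 / 3 : ℝ) := fun i hi => by
      rw [hL, ← sq_abs]
      calc _ ≤ (2 * h * ρ ^ (-1 / 3 : ℝ)) ^ 2 := by
            gcongr
            exact abs_lineDeriv_laminate_le h0 hρ hi
        _ = _ := by rw [hsq]; ring
    have hn := hb 0 (by decide)
    have hdd := hb 2 (by decide)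
    rw [frame_zero] at hn
    rw [frame_two] at hdd
    have hs : L b32 - slope h x = 0 := by rw [hL]; exact sub_self _
    have : 0 ≤ h ^ 2 * ρ ^ (-2 / 3 : ℝ) := by positivity
    rw [hs]
    linarith
  -- In the boundary layer the crude bound `4 + 9 + 4 = 17` suffices, because `h ^ 2 * ρ^(-2/3) ≥ 1`
  -- there.
  · have hL : ∀ i, |L (frame i)| ≤ 2 := fun i => by
      have h1 := L.le_opNorm (frame i)
      have h2 : ‖L‖ ≤ 2 := norm_fderiv_le_of_lipschitz ℝ (lipschitzWith_cutLaminate h0)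
      rw [frame.norm_eq_one, mul_one] at h1
      exact h1.trans h2
    have hn := abs_le.1 (hL 0)
    have hb := abs_le.1 (hL 1)
    have hdd := abs_le.1 (hL 2)
    rw [frame_zero] at hn
    rw [frame_one] at hb
    rw [frame_two] at hdd
    have hsl := abs_le.1 (abs_slope_le h x)
    have h1 : 1 ≤ h ^ 2 * ρ ^ (-2 / 3 : ℝ) := by
      have : h⁻¹ ≤ ρ ^ (-1 / 3 : ℝ) := by
        rw [← cube_rpow_neg_one_third h0]
        exact Real.rpow_le_rpow_of_nonpos hρ hge (by norm_num)
      rw [hsq]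
      calc (1 : ℝ) = h ^ 2 * (h⁻¹) ^ 2 := by field_simp
        _ ≤ _ := by gcongr
    have e1 : (L nVec) ^ 2 ≤ 2 ^ 2 := sq_le_sq' hn.1 hn.2
    have e2 : (L b32 - slope h x) ^ 2 ≤ 3 ^ 2 := sq_le_sq' (by linarith) (by linarith)
    have e3 : (L dVec) ^ 2 ≤ 2 ^ 2 := sq_le_sq' hdd.1 hdd.2
    linarith

/-! ### Weak gradients, the deformation and its elastic energy -/

theorem memL2loc_of_continuous {f : E3 → ℝ} (hf : Continuous f) : MemL2loc f := fun A hA => by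
  obtain ⟨C, hC⟩ := hA.exists_bound_of_continuousOn hf.continuousOn
  have := isFiniteMeasure_restrict.2 (hA.measure_lt_top (μ := volume)).ne
  refine MemLp.of_bound hf.aestronglyMeasurable C ?_
  filter_upwards [ae_restrict_mem hA.measurableSet] with x hx using hC x hx

theorem lipschitzWith_apply {u : E3 → E3} {K : NNReal} (hu : LipschitzWith K u) (i : Fin 3) :
    LipschitzWith K fun x => u x i :=
  LipschitzWith.of_dist_le_mul fun x y => by
    refine le_trans ?_ (hu.dist_le_mul x y)
    rw [Real.dist_eq, dist_eq_norm]
    exact PiLp.norm_apply_le (u x - u y) i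

/-- The matrix of partial derivatives. -/
noncomputable def jacobian (u : E3 → E3) (x : E3) : M3 :=
  Matrix.of fun i j => lineDeriv ℝ (fun x => u x i) x (EuclideanSpace.single j 1)

theorem isWeakGradient_jacobian {u : E3 → E3} {K : NNReal} (hu : LipschitzWith K u) :
    IsWeakGradient u (jacobian u) := by
  have hui := lipschitzWith_apply hu
  refine ⟨fun i => (hui i).continuous.locallyIntegrable,
    fun i j => (hui i).locallyIntegrable_lineDeriv _, fun i j φ hφ hc => ?_⟩
  obtain ⟨D, hD⟩ := hφ.lipschitzWith_of_hasCompactSupport hc (by simp)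
  have hpd : ∀ x, pderiv j φ x = lineDeriv ℝ φ x (EuclideanSpace.single j 1) := fun x =>
    ((hφ.differentiable (by simp)) x).lineDeriv_eq_fderiv.symm
  have := (hui i).integral_lineDeriv_mul_eq (μ := volume) hD hc (EuclideanSpace.single j 1)
  simp only [jacobian, Matrix.of_apply]
  rw [this, ← integral_neg]
  refine integral_congr_ae (Filter.Eventually.of_forall fun x => ?_)
  simp only [hpd, lineDeriv_neg]
  ring

theorem memH1loc_of_lipschitzWith {u : E3 → E3} {K : NNReal} (hu : LipschitzWith K u) :
    MemH1loc u := by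
  have hui := lipschitzWith_apply hu
  refine ⟨fun i => memL2loc_of_continuous (hui i).continuous, jacobian u,
    isWeakGradient_jacobian hu, fun i j A hA => ?_⟩
  have := isFiniteMeasure_restrict.2 (hA.measure_lt_top (μ := volume)).ne
  exact ((hui i).memLp_lineDeriv (μ := volume.restrict A) _).mono_exponent le_top

/-- The unit vector `b₂₃ = (0, 1, 1) / √2`, the amplitude direction of the laminate. -/
noncomputable def b23 : E3 := (1 / √2 : ℝ) • !₂[0, 1, 1]

/-- The deformation of the branching construction. -/
noncomputable def deformation (h : ℝ) (x : E3) : E3 :=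
  Matrix.toEuclideanLin F x + (3 * cutLaminate h x) • b23

theorem lipschitzWith_deformation {h : ℝ} (hh : 0 < h) :
    ∃ K, LipschitzWith K (deformation h) := by
  have h1 := (LinearMap.toContinuousLinearMap (Matrix.toEuclideanLin F)).lipschitz
  have h2 : LipschitzWith (6 * ‖b23‖₊) fun x => (3 * cutLaminate h x) • b23 :=
    LipschitzWith.of_dist_le_mul fun x y => by
      have := (lipschitzWith_cutLaminate hh).dist_le_mul x y
      rw [Real.dist_eq] at this
      rw [dist_eq_norm, ← sub_smul, ← mul_sub, norm_smul, Real.norm_eq_abs, abs_mul]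
      push_cast at this ⊢
      rw [abs_of_pos (show (0 : ℝ) < 3 by norm_num)]
      calc 3 * |cutLaminate h x - cutLaminate h y| * ‖b23‖ ≤ 3 * (2 * dist x y) * ‖b23‖ := by
            gcongr
        _ = _ := by ring
  exact ⟨_, h1.add h2⟩

theorem deformation_mem_admissible {h : ℝ} (hh : 0 < h) : deformation h ∈ admissible Ω F := by
  obtain ⟨K, hK⟩ := lipschitzWith_deformation hh
  refine ⟨memH1loc_of_lipschitzWith hK, 0, Filter.Eventually.of_forall fun x hx => ?_⟩
  rw [deformation, cutLaminate_of_notMem fun hx' => hx (subset_closure hx')]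
  simp

theorem jacobian_deformation {h : ℝ} {x : E3} (hd : DifferentiableAt ℝ (cutLaminate h) x)
    (i j : Fin 3) : jacobian (deformation h) x i j =
      F i j + 3 * b23 i * fderiv ℝ (cutLaminate h) x (EuclideanSpace.single j 1) := by
  have h1 : HasFDerivAt (deformation h)
      (LinearMap.toContinuousLinearMap (Matrix.toEuclideanLin F) +
        ((3 : ℝ) • fderiv ℝ (cutLaminate h) x).smulRight b23) x :=
    (LinearMap.toContinuousLinearMap (Matrix.toEuclideanLin F)).hasFDerivAt.add
      ((hd.hasFDerivAt.const_mul 3).smul_const b23)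
  have h2 := (EuclideanSpace.proj (𝕜 := ℝ) i).hasFDerivAt.comp x h1
  have h3 := h2.hasLineDerivAt (EuclideanSpace.single j 1)
  rw [jacobian, Matrix.of_apply]
  refine h3.lineDeriv.trans ?_
  simp [Matrix.toEuclideanLin]
  ring

/-- The amplitude 3 makes the part of the gradient along `slope • b32` reproduce the phase exactly.
The error is `3 sym(b23 ⊗ q)` with `q = ∇φ - slope • b32`, where `φ` is `cutLaminate h`, and
`|sym(b23 ⊗ q)| ≤ |q|` as `b23` is a unit vector. -/
theorem frobSq_symPart_sub_phase_le {h : ℝ} {x : E3} (hs : slope h x = 1 ∨ slope h x = -1)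
    (hd : DifferentiableAt ℝ (cutLaminate h) x) :
    frobSq (symPart (jacobian (deformation h) x) - phase h x) ≤
      9 * ((fderiv ℝ (cutLaminate h) x nVec) ^ 2 +
        (fderiv ℝ (cutLaminate h) x b32 - slope h x) ^ 2 +
          (fderiv ℝ (cutLaminate h) x dVec) ^ 2) := by
  set L := fderiv ℝ (cutLaminate h) x with hL
  set q : E3 := (InnerProductSpace.toDual ℝ E3).symm L - slope h x • b32 with hq
  have hqi : ∀ v, inner ℝ q v = L v - slope h x * inner ℝ b32 v := fun v => by
    rw [hq, inner_sub_left, InnerProductSpace.toDual_symm_apply, real_inner_smul_left]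
  have hqj : ∀ j, L (EuclideanSpace.single j 1) = q j + slope h x * b32 j := fun j => by
    have := hqi (EuclideanSpace.single j 1)
    rw [EuclideanSpace.inner_single_right, EuclideanSpace.inner_single_right] at this
    simp only [conj_trivial, one_mul] at this
    linarith
  have hnorm : (L nVec) ^ 2 + (L b32 - slope h x) ^ 2 + (L dVec) ^ 2 =
      q 0 ^ 2 + q 1 ^ 2 + q 2 ^ 2 := by
    have e1 := frame.sum_sq_norm_inner_left q
    have e2 := EuclideanSpace.norm_sq_eq q
    rw [← e1, Fin.sum_univ_three, Fin.sum_univ_three] at e2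
    simp only [Real.norm_eq_abs, sq_abs] at e2
    have o1 : inner ℝ b32 nVec = 0 := by
      have := frame.inner_eq_ite 1 0; simpa using this
    have o2 : inner ℝ b32 b32 = 1 := by
      rw [real_inner_self_eq_norm_sq, norm_b32, one_pow]
    have o3 : inner ℝ b32 dVec = 0 := by
      have := frame.inner_eq_ite 1 2; simpa using this
    rw [frame_zero, frame_one, frame_two, hqi, hqi, hqi, o1, o2, o3, mul_zero, mul_one, sub_zero,
      sub_zero] at e2
    exact e2
  have hsq : (√2)⁻¹ * (√2)⁻¹ = 1 / 2 := by
    rw [← mul_inv, Real.mul_self_sqrt (by norm_num)]; norm_num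
  rw [hnorm]
  have hent : ∀ i j, (symPart (jacobian (deformation h) x) - phase h x) i j =
      3 / 2 * (b23 i * q j + b23 j * q i) := by
    intro i j
    rw [Matrix.sub_apply, phase_eq hs]
    simp only [symPart, Matrix.smul_apply, Matrix.add_apply, Matrix.transpose_apply,
      jacobian_deformation hd, ← hL, hqj]
    fin_cases i <;> fin_cases j <;> simp [F, e2, e3, b23, b32] <;> 
      first
      | linear_combination (0 : ℝ) * hsq
      | linear_combination (-3 * slope h x) * hsq
      | linear_combination (3 * slope h x) * hsq
  simp only [frobSq, hent, Fin.sum_univ_three]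
  have b0 : b23 0 = 0 := by simp [b23]
  have b1 : b23 1 = (√2)⁻¹ := by simp [b23]
  have b2 : b23 2 = (√2)⁻¹ := by simp [b23]
  rw [b0, b1, b2]
  set s := (√2)⁻¹
  have hs2 : s ^ 2 = 1 / 2 := by rw [sq]; exact hsq
  nlinarith [sq_nonneg (q 1 - q 2)]

theorem elasticEnergy_deformation_le {h : ℝ} {m : ℕ} (hm : 0 < m) (hh : h = 1 / (2 * m)) :
    elasticEnergy Ω (deformation h) (phase h) ≤
      ENNReal.ofReal (153 * h ^ 2 * (∫⁻ p in square, weight p).toReal) := by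
  have h0 := period_pos hm hh
  obtain ⟨K, hK⟩ := lipschitzWith_deformation h0
  refine (iInf₂_le _ (isWeakGradient_jacobian hK)).trans ?_
  rw [ENNReal.ofReal_mul (by positivity), ENNReal.ofReal_toReal lintegral_weight_lt_top.ne,
    ← lintegral_weight_Ω, ← lintegral_const_mul (f := fun x => weight (lateral x)) _
      (measurable_weight.comp continuous_lateral.measurable)]
  refine lintegral_mono_ae ?_
  filter_upwards [slope_eq_one_or_neg_one hm hh, ae_restrict_mem isOpen_Ω.measurableSet,
    ae_restrict_of_ae (lipschitzWith_cutLaminate h0).ae_differentiableAt] with x hs hx hd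
  rw [weight, ← ENNReal.ofReal_mul (by positivity)]
  apply ENNReal.ofReal_le_ofReal
  have h1 := frobSq_symPart_sub_phase_le hs hd
  have h2 := sum_sq_fderiv_cutLaminate_le hm hh hx hd
  -- `153 = 9 * 17`.
  linarith

end CubicTetragonal

/-! ### Choice of the period -/

open CubicTetragonal
theorem theorem4 :
    ∃ ε₀ : ℝ, 0 < ε₀ ∧ ∃ C : ℝ, 1 < C ∧ ∀ ε : ℝ, 0 < ε → ε < ε₀ →
      ∃ (u : E3 → E3) (χ : E3 → M3),
        (∃ L, LipschitzOnWith L u Ω) ∧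
        u ∈ admissible Ω F ∧
        MemBV Ω {e2, e3} χ ∧
        elasticEnergy Ω u χ + ENNReal.ofReal ε * surfaceEnergy Ω χ
          ≤ ENNReal.ofReal (C * ε ^ (2 / 3 : ℝ)) := by
  set κ := (∫⁻ p in square, weight p).toReal with hκ
  have hκ0 : 0 ≤ κ := ENNReal.toReal_nonneg
  -- `9000` exceeds `153 + 8000`; the summand 2 only ensures `1 < C`.
  refine ⟨1, one_pos, 2 + 9000 * κ, by linarith, fun ε hε hε1 => ?_⟩
  set t := ε ^ (1 / 3 : ℝ) with ht
  have ht0 : 0 < t := Real.rpow_pos_of_pos hε _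
  have ht1 : t ≤ 1 := Real.rpow_le_one hε.le hε1.le (by norm_num)
  have ht2 : ε ^ (2 / 3 : ℝ) = t ^ 2 := by
    rw [ht, ← Real.rpow_natCast, ← Real.rpow_mul hε.le]; norm_num
  have ht3 : ε = t ^ 3 := by
    rw [ht, ← Real.rpow_natCast, ← Real.rpow_mul hε.le]; norm_num
  -- Rounding makes the half-width of the cube a whole number of periods while keeping `t / 4 ≤ h ≤
  -- t`, with `t = ε^(1/3)`.
  set m := ⌈t⁻¹⌉₊ with hmdef
  have hm : 0 < m := Nat.ceil_pos.2 (by positivity)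
  have hm1 : t⁻¹ ≤ m := Nat.le_ceil _
  have hm2 : (m : ℝ) < t⁻¹ + 1 := Nat.ceil_lt_add_one (by positivity)
  have hmR : (0 : ℝ) < m := by exact_mod_cast hm
  set h : ℝ := 1 / (2 * m) with hh
  have h0 : 0 < h := period_pos hm hh
  have hht : h ≤ t := by
    rw [hh, div_le_iff₀ (by positivity)]
    have : t * t⁻¹ ≤ t * m := by gcongr
    rw [mul_inv_cancel₀ ht0.ne'] at this
    linarith
  have hhinv : 1 / h ≤ 4 * t⁻¹ := by
    have : 1 ≤ t⁻¹ := (one_le_inv₀ ht0).2 ht1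
    rw [hh, one_div_one_div]
    linarith
  obtain ⟨K, hK⟩ := lipschitzWith_deformation h0
  refine ⟨deformation h, phase h, ⟨K, hK.lipschitzOnWith⟩, deformation_mem_admissible h0,
    memBV_phase hm hh, ?_⟩
  calc _ ≤ ENNReal.ofReal (153 * h ^ 2 * κ) + ENNReal.ofReal ε * ENNReal.ofReal (2000 / h * κ) := by
        gcongr
        · exact elasticEnergy_deformation_le hm hh
        · exact surfaceEnergy_phase_le hm hh
    _ = ENNReal.ofReal (153 * h ^ 2 * κ + ε * (2000 / h * κ)) := by
        rw [← ENNReal.ofReal_mul hε.le, ← ENNReal.ofReal_add (by positivity) (by positivity)]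
    _ ≤ _ := by
        apply ENNReal.ofReal_le_ofReal
        rw [ht2]
        have a1 : 153 * h ^ 2 * κ ≤ 153 * t ^ 2 * κ := by gcongr
        have a2 : ε * (2000 / h * κ) ≤ 8000 * t ^ 2 * κ := by
          calc ε * (2000 / h * κ) = t ^ 3 * 2000 * κ * (1 / h) := by rw [← ht3]; ring
            _ ≤ t ^ 3 * 2000 * κ * (4 * t⁻¹) := by gcongr
            _ = _ := by field_simp; ring
        have a3 : 0 ≤ t ^ 2 * κ := by positivity
        have a4 : 0 ≤ t ^ 2 := by positivity
        nlinarith
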